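/- Let $n\ge 0$ be an integer and $u\in\mathbb C$. Write $s_{ij}\in S_n$ for the transposition of $i$ and $j$, and $s_i=s_{i,i+1}$; $[a,b]=ab-ba$. Let $\mathcal C_n\rtimes\mathbb CS_n$ be the algebra generated by $c_1,\dots,c_n$ and the group $S_n$ with relations $c_i^2=1$, $c_ic_j=-c_jc_i$ $(i\ne j)$, $\sigma c_i=c_{\sigma i}\sigma$ $(\sigma\in S_n)$. The rational double affine Hecke--Clifford algebra $\ddot{\mathfrak H}^{\mathfrak c}$ is the $\mathbb C$-algebra generated by $x_i,y_i,c_i$ $(1\le i\le n)$ and $S_n$, subject to the relations above and $$x_ix_j=x_jx_i,\quad y_iy_j=y_jy_i,\quad \sigma x_i=x_{\sigma i}\sigma,\quad \sigma y_i=y_{\sigma i}\sigma,$$ $$c_ix_i=-x_ic_i,\quad c_jx_i=x_ic_j\ (i\neq j),\quad c_jy_i=y_ic_j\ (\forall i,j),$$ $$[y_j,x_i]=u(1+c_jc_i)s_{ij}\ (i\ne j),\qquad [y_i,x_i]=-u\sum_{k\ne i}(1+c_kc_i)s_{ki}.$$ Let $P=\bigoplus_{i=1}^n\mathbb Z\epsilon_i$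 with $\sigma\epsilon_i=\epsilon_{\sigma i}$. The trigonometric double affine Hecke--Clifford algebra $\ddot{\mathfrak H}^{\mathfrak c}_{tr}$ is the $\mathbb C$-algebra generated by the group algebra $\mathbb C[P]$ (with basis $e^\eta$, $\eta\in P$; it is generated by $e^{\pm\epsilon_i}$), $\epsilon_i^\vee,c_i$ $(1\le i\le n)$ and $S_n$, subject to the relations of $\mathcal C_n\rtimes\mathbb CS_n$ and $$\epsilon_i^\vee\epsilon_j^\vee=\epsilon_j^\vee\epsilon_i^\vee,\quad c_je^{\epsilon_i}=e^{\epsilon_i}c_j,\quad \sigma e^{\epsilon_i}=e^{\epsilon_{\sigma i}}\sigma,\quad c_i\epsilon_i^\vee=-\epsilon_i^\vee c_i,\quad c_j\epsilon_i^\vee=\epsilon_i^\vee c_j\ (i\ne j),$$ $$\epsilon_{i+1}^\vee s_i-s_i\epsilon_i^\vee=u(1-c_{i+1}c_i),\qquad \epsilon_j^\vee s_i=s_i\epsilon_j^\vee\ (j\ne i,i+1),$$ $$[\epsilon_i^\vee,e^\eta]=u\sum_{k\ne i}\mathrm{sgn}(k-i)\,\frac{e^\eta-e^{s_{ki}(\eta)}}{1-e^{\mathrm{sgn}(k-i)(\epsilon_k-\epsilon_i)}}\,(1-c_ic_k)s_{ki}\qquad(\eta\in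 P),$$ where the quotients are taken in $\mathbb C[P]$. Both algebras are superalgebras ($\mathbb Z/2$-graded) with the $c_i$ odd and all other generators even. (1) There is a unique superalgebra homomorphism $\iota:\ddot{\mathfrak H}^{\mathfrak c}\to\ddot{\mathfrak H}^{\mathfrak c}_{tr}$ that is the identity on $\mathcal C_n\rtimes\mathbb CS_n$ and satisfies, for all $i$, $$\iota(y_i)=e^{\epsilon_i},\qquad \iota(x_i)=e^{-\epsilon_i}\Bigl(\epsilon_i^\vee-u\sum_{k<i}(1-c_ic_k)s_{ki}\Bigr).$$ Moreover, $\iota$ is injective. (2) Give $\mathbb C[\underline y^{\pm}]\otimes_{\mathbb C[\underline y]}\ddot{\mathfrak H}^{\mathfrak c}$ (where $\mathbb C[\underline y]=\mathbb C[y_1,\dots,y_n]$ acts on $\ddot{\mathfrak H}^{\mathfrak c}$ by left multiplication and $\mathbb C[\underline y^\pm]$ is the Laurent polynomial ring) the algebra structure such that $p\mapsto p\otimes1$ and $h\mapsto 1\otimes h$ are algebra homomorphisms and $p\otimes h=(p\otimes1)(1\otimes h)$. Then $\iota$ extends to an algebra isomorphism $$\mathbb C[\underline y^{\pm}]\otimes_{\mathbb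 C[\underline y]}\ddot{\mathfrak H}^{\mathfrak c}\ \xrightarrow{\ \cong\ }\ \ddot{\mathfrak H}^{\mathfrak c}_{tr},$$ whose inverse $j$ is the identity on $\mathcal C_n\rtimes\mathbb CS_n$ and satisfies, for all $i$, $$j(e^{\epsilon_i})=y_i,\qquad j(\epsilon_i^\vee)=y_ix_i+u\sum_{k<i}(1-c_ic_k)s_{ki}.$$ -/

import Mathlib

open scoped TensorProduct

noncomputable section

/-! ### Superalgebra structures given by a parity involution -/

/-- The homogeneous components of an algebra with a parity map `θ`: the component of degree `i` in
`ℤ/2` is the eigenspace of `θ` with eigenvalue `(-1)^i`. -/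
def parityGrading {A : Type*} [Ring A] [Algebra ℂ A] (θ : A →ₐ[ℂ] A) (i : ZMod 2) :
    Submodule ℂ A where
  carrier := {a | θ a = (-1 : ℂ) ^ i.val • a}
  add_mem' := by
    intro a b (ha : _ = _) (hb : _ = _)
    show _ = _
    rw [map_add, ha, hb, smul_add]
  zero_mem' := by simp
  smul_mem' := by
    intro t a (ha : _ = _)
    show _ = _
    rw [map_smul, ha, smul_comm]

theorem mem_parityGrading {A : Type*} [Ring A] [Algebra ℂ A] (θ : A →ₐ[ℂ] A) (i : ZMod 2) (a : A) :
    a ∈ parityGrading θ i ↔ θ a = (-1 : ℂ) ^ i.val • a := Iff.rfl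

/-- The projection `a ↦ (a + (-1)^i θ(a)) / 2` onto the component of degree `i`. -/
def parityProj {A : Type*} [Ring A] [Algebra ℂ A] (θ : A →ₐ[ℂ] A)
    (hθ : ∀ a, θ (θ a) = a) (i : ZMod 2) : A →ₗ[ℂ] parityGrading θ i :=
  LinearMap.codRestrict _ ((2 : ℂ)⁻¹ • (LinearMap.id + (-1 : ℂ) ^ i.val • θ.toLinearMap)) (by
    intro a
    rw [mem_parityGrading]
    have h : (-1 : ℂ) ^ i.val * (-1 : ℂ) ^ i.val = 1 := by
      rw [← mul_pow]; simp
    simp only [LinearMap.smul_apply, LinearMap.add_apply, LinearMap.id_apply,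
      AlgHom.toLinearMap_apply, map_smul, map_add, hθ]
    rw [smul_comm ((-1 : ℂ) ^ i.val)]
    congr 1
    rw [smul_add, smul_smul, h, one_smul, add_comm])

theorem parityProj_apply {A : Type*} [Ring A] [Algebra ℂ A] (θ : A →ₐ[ℂ] A)
    (hθ : ∀ a, θ (θ a) = a) (i : ZMod 2) (a : A) :
    (parityProj θ hθ i a : A) = (2 : ℂ)⁻¹ • (a + (-1 : ℂ) ^ i.val • θ a) := rfl

/-- The eigenspaces of an involutive algebra endomorphism form a `ℤ/2`-grading. -/
@[reducible] def parityGradedAlgebra {A : Type*} [Ring A] [Algebra ℂ A] (θ : A →ₐ[ℂ] A)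
    (hθ : ∀ a, θ (θ a) = a) : GradedAlgebra (parityGrading θ) :=
  { DirectSum.Decomposition.ofLinearMap (parityGrading θ)
      (DirectSum.lof ℂ (ZMod 2) (fun i => parityGrading θ i) 0 ∘ₗ parityProj θ hθ 0 +
        DirectSum.lof ℂ (ZMod 2) (fun i => parityGrading θ i) 1 ∘ₗ parityProj θ hθ 1)
      (by
        ext a
        simp only [LinearMap.comp_apply, LinearMap.add_apply, map_add,
          DirectSum.coeLinearMap_lof, parityProj_apply, LinearMap.id_apply]
        rw [← smul_add]
        simp only [ZMod.val_zero, ZMod.val_one, pow_zero, pow_one, one_smul, neg_smul]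
        rw [show a + θ a + (a + -θ a) = (2 : ℂ) • a by rw [two_smul]; abel, smul_smul]
        simp)
      (by
        have h2 : ∀ i : ZMod 2, i = 0 ∨ i = 1 := by decide
        have h01 : (0 : ZMod 2) ≠ 1 := by decide
        have key : ∀ (i j : ZMod 2) (x : A) (hx : x ∈ parityGrading θ i),
            parityProj θ hθ j x = if h : i = j then ⟨x, h ▸ hx⟩ else 0 := by
          intro i j x hx
          apply Subtype.ext
          rw [parityProj_apply, (mem_parityGrading θ i x).1 hx, smul_smul]
          nth_rewrite 1 [← one_smul ℂ x]
          rw [← add_smul, smul_smul]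
          split_ifs with h
          · subst h
            rw [← mul_pow]; norm_num
          · have : (-1 : ℂ) ^ j.val * (-1 : ℂ) ^ i.val = -1 := by
              rcases h2 i with rfl | rfl <;> rcases h2 j with rfl | rfl <;>
                simp_all [ZMod.val_one]
            rw [this]; norm_num
        refine DirectSum.linearMap_ext ℂ fun i => LinearMap.ext fun x => ?_
        obtain ⟨x, hx⟩ := x
        simp only [LinearMap.comp_apply, LinearMap.add_apply, DirectSum.coeLinearMap_lof,
          LinearMap.id_apply, key i _ x hx]
        rcases h2 i with rfl | rfl
        · rw [dif_pos rfl, dif_neg h01, map_zero, add_zero]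
        · rw [dif_pos rfl, dif_neg h01.symm, map_zero, zero_add]) with
    one_mem := by simp [mem_parityGrading]
    mul_mem := by
      intro i j a b ha hb
      rw [mem_parityGrading] at *
      rw [map_mul, ha, hb, smul_mul_smul_comm]
      congr 1
      rw [ZMod.val_add, ← pow_add, neg_one_pow_eq_pow_mod_two] }

/-! ### The algebra `𝒞ₙ ⋊ ℂSₙ` -/

/-- Generators of `𝒞ₙ ⋊ ℂSₙ`: the Clifford generators `cᵢ` and the permutations. -/
inductive CliffordPermGen (n : ℕ) : Type
  | c (i : Fin n)
  | s (σ : Equiv.Perm (Fin n))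

namespace CliffordPermGen

/-- The defining relations of `𝒞ₙ ⋊ ℂSₙ`. -/
inductive Rel (n : ℕ) :
    FreeAlgebra ℂ (CliffordPermGen n) → FreeAlgebra ℂ (CliffordPermGen n) → Prop
  | s_one : Rel n (FreeAlgebra.ι ℂ (s 1)) 1
  | s_mul (σ τ : Equiv.Perm (Fin n)) :
      Rel n (FreeAlgebra.ι ℂ (s (σ * τ))) (FreeAlgebra.ι ℂ (s σ) * FreeAlgebra.ι ℂ (s τ))
  | c_sq (i : Fin n) : Rel n (FreeAlgebra.ι ℂ (c i) * FreeAlgebra.ι ℂ (c i)) 1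
  | c_c (i j : Fin n) (h : i ≠ j) :
      Rel n (FreeAlgebra.ι ℂ (c i) * FreeAlgebra.ι ℂ (c j))
        (-(FreeAlgebra.ι ℂ (c j) * FreeAlgebra.ι ℂ (c i)))
  | s_c (σ : Equiv.Perm (Fin n)) (i : Fin n) :
      Rel n (FreeAlgebra.ι ℂ (s σ) * FreeAlgebra.ι ℂ (c i))
        (FreeAlgebra.ι ℂ (c (σ i)) * FreeAlgebra.ι ℂ (s σ))

end CliffordPermGen

/-- The algebra `𝒞ₙ ⋊ ℂSₙ`, the semidirect product of the Clifford algebra on `c₁, …, cₙ` and the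
group algebra of the symmetric group. -/
def CliffordPerm (n : ℕ) : Type := RingQuot (CliffordPermGen.Rel n)

instance (n : ℕ) : Ring (CliffordPerm n) := inferInstanceAs (Ring (RingQuot _))
instance (n : ℕ) : Algebra ℂ (CliffordPerm n) := inferInstanceAs (Algebra ℂ (RingQuot _))

namespace CliffordPerm

/-- The generator `cᵢ`. -/
def c {n : ℕ} (i : Fin n) : CliffordPerm n :=
  RingQuot.mkAlgHom ℂ (CliffordPermGen.Rel n) (FreeAlgebra.ι ℂ (CliffordPermGen.c i))

/-- The permutation `σ`, as an element of `𝒞ₙ ⋊ ℂSₙ`. -/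
def s {n : ℕ} (σ : Equiv.Perm (Fin n)) : CliffordPerm n :=
  RingQuot.mkAlgHom ℂ (CliffordPermGen.Rel n) (FreeAlgebra.ι ℂ (CliffordPermGen.s σ))

/-- The algebra homomorphism out of `𝒞ₙ ⋊ ℂSₙ` given by images of the generators. -/
def lift {n : ℕ} {A : Type} [Ring A] [Algebra ℂ A] (C : Fin n → A) (S : Equiv.Perm (Fin n) → A)
    (s_one : S 1 = 1) (s_mul : ∀ σ τ, S (σ * τ) = S σ * S τ) (c_sq : ∀ i, C i * C i = 1)
    (c_c : ∀ i j, i ≠ j → C i * C j = -(C j * C i)) (s_c : ∀ σ i, S σ * C i = C (σ i) * S σ) :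
    CliffordPerm n →ₐ[ℂ] A :=
  RingQuot.liftAlgHom ℂ (s := CliffordPermGen.Rel n)
    ⟨FreeAlgebra.lift ℂ fun g => match g with
      | CliffordPermGen.c i => C i
      | CliffordPermGen.s σ => S σ, by
      intro a b h
      cases h <;> simp only [map_mul, map_one, map_neg, FreeAlgebra.lift_ι_apply]
      · exact s_one
      · exact s_mul _ _
      · exact c_sq _
      · exact c_c _ _ ‹_›
      · exact s_c _ _⟩

end CliffordPerm

/-! ### The rational double affine Hecke-Clifford algebra -/

/-- Generators of the rational double affine Hecke-Clifford algebra. -/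
inductive RationalGen (n : ℕ) : Type
  | x (i : Fin n)
  | y (i : Fin n)
  | c (i : Fin n)
  | s (σ : Equiv.Perm (Fin n))

namespace RationalGen

/-- The generator `xᵢ` of the free algebra. -/
abbrev X {n : ℕ} (i : Fin n) : FreeAlgebra ℂ (RationalGen n) := FreeAlgebra.ι ℂ (x i)
/-- The generator `yᵢ` of the free algebra. -/
abbrev Y {n : ℕ} (i : Fin n) : FreeAlgebra ℂ (RationalGen n) := FreeAlgebra.ι ℂ (y i)
/-- The generator `cᵢ` of the free algebra. -/
abbrev C {n : ℕ} (i : Fin n) : FreeAlgebra ℂ (RationalGen n) := FreeAlgebra.ι ℂ (c i)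
/-- The generator `σ ∈ Sₙ` of the free algebra. -/
abbrev S {n : ℕ} (σ : Equiv.Perm (Fin n)) : FreeAlgebra ℂ (RationalGen n) := FreeAlgebra.ι ℂ (s σ)

open Equiv (swap) in
/-- The defining relations of the rational double affine Hecke-Clifford algebra. -/
inductive Rel (n : ℕ) (u : ℂ) :
    FreeAlgebra ℂ (RationalGen n) → FreeAlgebra ℂ (RationalGen n) → Prop
  | s_one : Rel n u (S 1) 1
  | s_mul (σ τ : Equiv.Perm (Fin n)) : Rel n u (S (σ * τ)) (S σ * S τ)
  | x_x (i j : Fin n) : Rel n u (X i * X j) (X j * X i)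
  | y_y (i j : Fin n) : Rel n u (Y i * Y j) (Y j * Y i)
  | s_x (σ : Equiv.Perm (Fin n)) (i : Fin n) : Rel n u (S σ * X i) (X (σ i) * S σ)
  | s_y (σ : Equiv.Perm (Fin n)) (i : Fin n) : Rel n u (S σ * Y i) (Y (σ i) * S σ)
  | c_x (i : Fin n) : Rel n u (C i * X i) (-(X i * C i))
  | c_y (i : Fin n) : Rel n u (C i * Y i) (Y i * C i)
  | c_x_ne (i j : Fin n) (h : i ≠ j) : Rel n u (C j * X i) (X i * C j)
  | c_y_ne (i j : Fin n) (h : i ≠ j) : Rel n u (C j * Y i) (Y i * C j)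
  | s_c (σ : Equiv.Perm (Fin n)) (i : Fin n) : Rel n u (S σ * C i) (C (σ i) * S σ)
  | c_sq (i : Fin n) : Rel n u (C i * C i) 1
  | c_c (i j : Fin n) (h : i ≠ j) : Rel n u (C i * C j) (-(C j * C i))
  | y_x_ne (i j : Fin n) (h : i ≠ j) :
      Rel n u (Y j * X i - X i * Y j) (u • ((1 + C j * C i) * S (swap i j)))
  | y_x (i : Fin n) :
      Rel n u (Y i * X i - X i * Y i)
        (-(u • ∑ k with k ≠ i, (1 + C k * C i) * S (swap k i)))

end RationalGen

/-- The rational double affine Hecke-Clifford algebra with parameter `u`. -/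
def RationalDaHCa (n : ℕ) (u : ℂ) : Type := RingQuot (RationalGen.Rel n u)

instance (n : ℕ) (u : ℂ) : Ring (RationalDaHCa n u) := inferInstanceAs (Ring (RingQuot _))
instance (n : ℕ) (u : ℂ) : Algebra ℂ (RationalDaHCa n u) :=
  inferInstanceAs (Algebra ℂ (RingQuot _))

namespace RationalDaHCa

variable {n : ℕ} {u : ℂ}

/-- The quotient map from the free algebra. -/
def mk (n : ℕ) (u : ℂ) : FreeAlgebra ℂ (RationalGen n) →ₐ[ℂ] RationalDaHCa n u :=
  RingQuot.mkAlgHom ℂ (RationalGen.Rel n u)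

theorem mk_surjective : Function.Surjective (mk n u) := RingQuot.mkAlgHom_surjective ℂ _

theorem mk_rel {a b : FreeAlgebra ℂ (RationalGen n)} (h : RationalGen.Rel n u a b) :
    mk n u a = mk n u b := RingQuot.mkAlgHom_rel ℂ h

/-- The generator `xᵢ`. -/
def x (i : Fin n) : RationalDaHCa n u := mk n u (RationalGen.X i)
/-- The generator `yᵢ`. -/
def y (i : Fin n) : RationalDaHCa n u := mk n u (RationalGen.Y i)
/-- The generator `cᵢ`. -/
def c (i : Fin n) : RationalDaHCa n u := mk n u (RationalGen.C i)
/-- The permutation `σ`, as an element of the algebra. -/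
def s (σ : Equiv.Perm (Fin n)) : RationalDaHCa n u := mk n u (RationalGen.S σ)

theorem s_one : (s 1 : RationalDaHCa n u) = 1 := by
  simpa [x, y, c, s] using mk_rel (.s_one)
theorem s_mul (σ τ : Equiv.Perm (Fin n)) : (s (σ * τ) : RationalDaHCa n u) = s σ * s τ := by
  simpa [x, y, c, s] using mk_rel (.s_mul σ τ)
theorem y_y (i j : Fin n) : (y i * y j : RationalDaHCa n u) = y j * y i := by
  simpa [x, y, c, s] using mk_rel (.y_y i j)
theorem s_y (σ : Equiv.Perm (Fin n)) (i : Fin n) :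
    (s σ * y i : RationalDaHCa n u) = y (σ i) * s σ := by
  simpa [x, y, c, s] using mk_rel (.s_y σ i)
theorem c_y (i j : Fin n) : (c j * y i : RationalDaHCa n u) = y i * c j := by
  by_cases h : i = j
  · subst h; simpa [x, y, c, s] using mk_rel (.c_y i)
  · simpa [x, y, c, s] using mk_rel (.c_y_ne i j h)
theorem s_c (σ : Equiv.Perm (Fin n)) (i : Fin n) :
    (s σ * c i : RationalDaHCa n u) = c (σ i) * s σ := by
  simpa [x, y, c, s] using mk_rel (.s_c σ i)
theorem c_sq (i : Fin n) : (c i * c i : RationalDaHCa n u) = 1 := by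
  simpa [x, y, c, s] using mk_rel (.c_sq i)
theorem c_c (i j : Fin n) (h : i ≠ j) : (c i * c j : RationalDaHCa n u) = -(c j * c i) := by
  simpa [x, y, c, s] using mk_rel (.c_c i j h)
theorem y_x_ne (i j : Fin n) (h : i ≠ j) :
    (y j * x i - x i * y j : RationalDaHCa n u) = u • ((1 + c j * c i) * s (Equiv.swap i j)) := by
  simpa [x, y, c, s] using mk_rel (.y_x_ne i j h)
theorem y_x (i : Fin n) :
    (y i * x i - x i * y i : RationalDaHCa n u) =
      -(u • ∑ k with k ≠ i, (1 + c k * c i) * s (Equiv.swap k i)) := by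
  simpa [x, y, c, s] using mk_rel (.y_x i)

/-- The parity map: `cᵢ ↦ -cᵢ`, while `xᵢ`, `yᵢ` and the permutations are fixed. -/
def parity (n : ℕ) (u : ℂ) : RationalDaHCa n u →ₐ[ℂ] RationalDaHCa n u :=
  RingQuot.liftAlgHom ℂ (s := RationalGen.Rel n u)
    ⟨FreeAlgebra.lift ℂ fun g => match g with
      | RationalGen.x i => x i
      | RationalGen.y i => y i
      | RationalGen.c i => -c i
      | RationalGen.s σ => s σ, by
      intro a b h
      have h' := mk_rel h
      cases h <;> simpa [x, y, c, s, neg_eq_iff_eq_neg] using h'⟩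

theorem parity_x (i : Fin n) : parity n u (x i) = x i :=
  (RingQuot.liftAlgHom_mkAlgHom_apply ℂ _ _ _).trans (FreeAlgebra.lift_ι_apply _ _)
theorem parity_y (i : Fin n) : parity n u (y i) = y i :=
  (RingQuot.liftAlgHom_mkAlgHom_apply ℂ _ _ _).trans (FreeAlgebra.lift_ι_apply _ _)
theorem parity_c (i : Fin n) : parity n u (c i) = -c i :=
  (RingQuot.liftAlgHom_mkAlgHom_apply ℂ _ _ _).trans (FreeAlgebra.lift_ι_apply _ _)
theorem parity_s (σ : Equiv.Perm (Fin n)) : parity n u (s σ) = s σ :=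
  (RingQuot.liftAlgHom_mkAlgHom_apply ℂ _ _ _).trans (FreeAlgebra.lift_ι_apply _ _)

theorem algHom_ext {A : Type*} [Semiring A] [Algebra ℂ A] {f g : RationalDaHCa n u →ₐ[ℂ] A}
    (hx : ∀ i, f (x i) = g (x i)) (hy : ∀ i, f (y i) = g (y i)) (hc : ∀ i, f (c i) = g (c i))
    (hs : ∀ σ, f (s σ) = g (s σ)) : f = g := by
  refine RingQuot.ringQuot_ext' ℂ _ _ (FreeAlgebra.hom_ext (funext fun k => ?_))
  cases k with
  | x i => exact hx i
  | y i => exact hy i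
  | c i => exact hc i
  | s σ => exact hs σ

theorem parity_parity (a : RationalDaHCa n u) : parity n u (parity n u a) = a := by
  have : (parity n u).comp (parity n u) = AlgHom.id ℂ _ :=
    algHom_ext (by simp [parity_x]) (by simp [parity_y]) (by simp [parity_c]) (by simp [parity_s])
  exact DFunLike.congr_fun this a

/-- The superalgebra structure: the `cᵢ` are odd, the other generators are even. -/
abbrev grading (n : ℕ) (u : ℂ) : ZMod 2 → Submodule ℂ (RationalDaHCa n u) :=
  parityGrading (parity n u)

instance : GradedAlgebra (grading n u) := parityGradedAlgebra _ parity_parity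

/-- The canonical map from `𝒞ₙ ⋊ ℂSₙ`. -/
def ofCliffordPerm (n : ℕ) (u : ℂ) : CliffordPerm n →ₐ[ℂ] RationalDaHCa n u :=
  CliffordPerm.lift c s s_one s_mul c_sq c_c s_c

end RationalDaHCa

/-! ### Laurent polynomials, i.e. the group algebra of the weight lattice of type `GLₙ` -/

/-- The weight lattice `P = ⨁ᵢ ℤ εᵢ`. -/
abbrev WeightLattice (n : ℕ) : Type := Fin n → ℤ

/-- The basis element `εᵢ` of the weight lattice. -/
def WeightLattice.eps {n : ℕ} (i : Fin n) : WeightLattice n := Pi.single i 1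

/-- The action of a permutation on the weight lattice, `σ εᵢ = ε_{σ i}`. -/
def WeightLattice.act {n : ℕ} (σ : Equiv.Perm (Fin n)) (η : WeightLattice n) : WeightLattice n :=
  fun i => η (σ.symm i)

theorem WeightLattice.act_eps {n : ℕ} (σ : Equiv.Perm (Fin n)) (i : Fin n) :
    act σ (eps i) = eps (σ i) := by
  funext j
  simp [act, eps, Pi.single_apply, Equiv.symm_apply_eq]

/-- The group algebra `ℂ[P]`, i.e. the Laurent polynomial ring in `n` variables. -/
abbrev LaurentRing (n : ℕ) : Type := AddMonoidAlgebra ℂ (WeightLattice n)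

/-- The basis element `e^η` of `ℂ[P]`. -/
def LaurentRing.e {n : ℕ} (η : WeightLattice n) : LaurentRing n := AddMonoidAlgebra.single η 1

namespace LaurentRing

variable {n : ℕ}

theorem e_zero : (e 0 : LaurentRing n) = 1 := rfl

theorem e_add (η θ : WeightLattice n) : e (η + θ) = e η * e θ := by
  simp [e, AddMonoidAlgebra.single_mul_single]

open WeightLattice in
/-- `e^η - e^{s_{ki} η}` is divisible by `1 - e^{m (ε_k - ε_i)}` for `m = ± 1`. -/
theorem exists_quotient (η : WeightLattice n) (i k : Fin n) (m : ℤ) (hm : m * m = 1) :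
    ∃ f : LaurentRing n, f * (1 - e (m • (eps k - eps i))) = e η - e (act (Equiv.swap k i) η) := by
  have pos : ∀ (θ β : WeightLattice n) (N : ℕ), ∃ f : LaurentRing n,
      f * (1 - e β) = e θ - e (θ + (N : ℤ) • β) := by
    intro θ β N
    induction N with
    | zero => exact ⟨0, by simp⟩
    | succ N ih =>
      obtain ⟨f, hf⟩ := ih
      refine ⟨f + e (θ + (N : ℤ) • β), ?_⟩
      rw [add_mul, hf, mul_sub, mul_one, ← e_add]
      rw [show θ + (N : ℤ) • β + β = θ + ((N + 1 : ℕ) : ℤ) • β by push_cast; rw [add_smul]; abel_nf]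
      abel
  have all : ∀ (θ β : WeightLattice n) (N : ℤ), ∃ f : LaurentRing n,
      f * (1 - e β) = e θ - e (θ + N • β) := by
    intro θ β N
    obtain ⟨N, rfl | rfl⟩ := N.eq_nat_or_neg
    · exact pos θ β N
    · obtain ⟨f, hf⟩ := pos (θ + (-(N : ℤ)) • β) β N
      refine ⟨-f, ?_⟩
      rw [neg_mul, hf, add_assoc, ← add_smul]
      simp
  obtain ⟨f, hf⟩ := all η (m • (eps k - eps i)) (m * (η i - η k))
  refine ⟨f, hf.trans ?_⟩
  congr 2
  rw [smul_smul, mul_right_comm, hm, one_mul]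
  funext j
  simp only [act, eps, Pi.add_apply, Pi.smul_apply, Pi.sub_apply, Pi.single_apply, smul_eq_mul,
    Equiv.symm_swap, Equiv.swap_apply_def]
  split_ifs <;> simp_all

theorem sign_mul_sign {i k : Fin n} (h : k ≠ i) :
    Int.sign ((k : ℤ) - i) * Int.sign ((k : ℤ) - i) = 1 := by
  have : (k : ℤ) - i ≠ 0 := by
    intro h'
    exact h (Fin.ext (by omega))
  rcases lt_or_gt_of_ne this with h' | h'
  · rw [Int.sign_eq_neg_one_of_neg h']; rfl
  · rw [Int.sign_eq_one_of_pos h']; rfl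

/-- The element `(e^η - e^{s_{ki} η}) / (1 - e^{sgn(k-i) (ε_k - ε_i)})` of `ℂ[P]`, for `k ≠ i`. -/
def quotient (η : WeightLattice n) (i k : Fin n) (h : k ≠ i) : LaurentRing n :=
  Classical.choose (exists_quotient η i k (Int.sign ((k : ℤ) - i)) (sign_mul_sign h))

open WeightLattice in
theorem quotient_mul (η : WeightLattice n) (i k : Fin n) (h : k ≠ i) :
    quotient η i k h * (1 - e (Int.sign ((k : ℤ) - i) • (eps k - eps i))) =
      e η - e (act (Equiv.swap k i) η) :=
  Classical.choose_spec (exists_quotient η i k (Int.sign ((k : ℤ) - i)) (sign_mul_sign h))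

open WeightLattice in
/-- The quotient is determined by the division property, as `ℂ[P]` is a domain. -/
theorem eq_quotient (η : WeightLattice n) (i k : Fin n) (h : k ≠ i) (f : LaurentRing n)
    (hf : f * (1 - e (Int.sign ((k : ℤ) - i) • (eps k - eps i))) =
      e η - e (act (Equiv.swap k i) η)) : f = quotient η i k h := by
  have h0 : (1 - e (Int.sign ((k : ℤ) - i) • (eps k - eps i)) : LaurentRing n) ≠ 0 := by
    intro h'
    rw [sub_eq_zero, ← e_zero] at h'
    have h1 := AddMonoidAlgebra.single_left_injective (one_ne_zero : (1 : ℂ) ≠ 0) h'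
    have h2 := congrFun h1 k
    have h3 := sign_mul_sign h
    simp [eps, h] at h2
    rw [← h2] at h3
    exact absurd h3 (by decide)
  exact mul_right_cancel₀ h0 (hf.trans (quotient_mul η i k h).symm)

end LaurentRing

/-! ### The trigonometric double affine Hecke-Clifford algebra -/

/-- Generators of the trigonometric double affine Hecke-Clifford algebra: the elements `e^η` of the
group algebra of the weight lattice, the `εᵢ^∨`, the `cᵢ`, and the permutations. -/
inductive TrigGen (n : ℕ) : Type
  | e (η : WeightLattice n)
  | ev (i : Fin n)
  | c (i : Fin n)
  | s (σ : Equiv.Perm (Fin n))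

namespace TrigGen

/-- The generator `e^η` of the free algebra. -/
abbrev E {n : ℕ} (η : WeightLattice n) : FreeAlgebra ℂ (TrigGen n) := FreeAlgebra.ι ℂ (e η)
/-- The generator `εᵢ^∨` of the free algebra. -/
abbrev EV {n : ℕ} (i : Fin n) : FreeAlgebra ℂ (TrigGen n) := FreeAlgebra.ι ℂ (ev i)
/-- The generator `cᵢ` of the free algebra. -/
abbrev C {n : ℕ} (i : Fin n) : FreeAlgebra ℂ (TrigGen n) := FreeAlgebra.ι ℂ (c i)
/-- The generator `σ ∈ Sₙ` of the free algebra. -/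
abbrev S {n : ℕ} (σ : Equiv.Perm (Fin n)) : FreeAlgebra ℂ (TrigGen n) := FreeAlgebra.ι ℂ (s σ)

/-- The linear map `ℂ[P] → ` free algebra sending the basis element `e^η` to the generator. -/
def ofLaurent {n : ℕ} (f : LaurentRing n) : FreeAlgebra ℂ (TrigGen n) :=
  f.coeff.sum fun η a => a • E η

open Equiv (swap) in
open WeightLattice in
/-- The defining relations of the trigonometric double affine Hecke-Clifford algebra. The first two
relations on the `e^η` say that they span a copy of the (commutative) group algebra of `P`; it is
generated by the mutually inverse elements `e^{±εᵢ}`. -/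
inductive Rel (n : ℕ) (u : ℂ) :
    FreeAlgebra ℂ (TrigGen n) → FreeAlgebra ℂ (TrigGen n) → Prop
  | e_zero : Rel n u (E 0) 1
  | e_add (η θ : WeightLattice n) : Rel n u (E (η + θ)) (E η * E θ)
  | s_one : Rel n u (S 1) 1
  | s_mul (σ τ : Equiv.Perm (Fin n)) : Rel n u (S (σ * τ)) (S σ * S τ)
  | c_sq (i : Fin n) : Rel n u (C i * C i) 1
  | c_c (i j : Fin n) (h : i ≠ j) : Rel n u (C i * C j) (-(C j * C i))
  | ev_ev (i j : Fin n) : Rel n u (EV i * EV j) (EV j * EV i)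
  | c_e (i j : Fin n) : Rel n u (C j * E (eps i)) (E (eps i) * C j)
  | s_e (σ : Equiv.Perm (Fin n)) (i : Fin n) :
      Rel n u (S σ * E (eps i)) (E (eps (σ i)) * S σ)
  | s_c (σ : Equiv.Perm (Fin n)) (i : Fin n) : Rel n u (S σ * C i) (C (σ i) * S σ)
  | c_ev (i : Fin n) : Rel n u (C i * EV i) (-(EV i * C i))
  | c_ev_ne (i j : Fin n) (h : i ≠ j) : Rel n u (C j * EV i) (EV i * C j)
  | ev_s (i j : Fin n) (h : (j : ℕ) = i + 1) :
      Rel n u (EV j * S (swap i j) - S (swap i j) * EV i) (u • (1 - C j * C i))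
  | ev_s_ne (i j k : Fin n) (h : (j : ℕ) = i + 1) (hi : k ≠ i) (hj : k ≠ j) :
      Rel n u (EV k * S (swap i j)) (S (swap i j) * EV k)
  | ev_e (i : Fin n) (η : WeightLattice n) :
      Rel n u (EV i * E η - E η * EV i)
        (u • ∑ k : {k : Fin n // k ≠ i}, Int.sign ((k.1 : ℤ) - i) •
          (ofLaurent (LaurentRing.quotient η i k.1 k.2) * (1 - C i * C k.1) * S (swap k.1 i)))

end TrigGen

/-- The trigonometric double affine Hecke-Clifford algebra with parameter `u`. -/
def TrigDaHCa (n : ℕ) (u : ℂ) : Type := RingQuot (TrigGen.Rel n u)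

instance (n : ℕ) (u : ℂ) : Ring (TrigDaHCa n u) := inferInstanceAs (Ring (RingQuot _))
instance (n : ℕ) (u : ℂ) : Algebra ℂ (TrigDaHCa n u) :=
  inferInstanceAs (Algebra ℂ (RingQuot _))

namespace TrigDaHCa

variable {n : ℕ} {u : ℂ}

/-- The quotient map from the free algebra. -/
def mk (n : ℕ) (u : ℂ) : FreeAlgebra ℂ (TrigGen n) →ₐ[ℂ] TrigDaHCa n u :=
  RingQuot.mkAlgHom ℂ (TrigGen.Rel n u)

theorem mk_surjective : Function.Surjective (mk n u) := RingQuot.mkAlgHom_surjective ℂ _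

theorem mk_rel {a b : FreeAlgebra ℂ (TrigGen n)} (h : TrigGen.Rel n u a b) :
    mk n u a = mk n u b := RingQuot.mkAlgHom_rel ℂ h

/-- The element `e^η`. -/
def e (η : WeightLattice n) : TrigDaHCa n u := mk n u (TrigGen.E η)
/-- The element `εᵢ^∨`. -/
def ev (i : Fin n) : TrigDaHCa n u := mk n u (TrigGen.EV i)
/-- The generator `cᵢ`. -/
def c (i : Fin n) : TrigDaHCa n u := mk n u (TrigGen.C i)
/-- The permutation `σ`, as an element of the algebra. -/
def s (σ : Equiv.Perm (Fin n)) : TrigDaHCa n u := mk n u (TrigGen.S σ)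

theorem s_one : (s 1 : TrigDaHCa n u) = 1 := by
  simpa [e, ev, c, s] using mk_rel (.s_one)
theorem s_mul (σ τ : Equiv.Perm (Fin n)) : (s (σ * τ) : TrigDaHCa n u) = s σ * s τ := by
  simpa [e, ev, c, s] using mk_rel (.s_mul σ τ)
theorem s_c (σ : Equiv.Perm (Fin n)) (i : Fin n) :
    (s σ * c i : TrigDaHCa n u) = c (σ i) * s σ := by
  simpa [e, ev, c, s] using mk_rel (.s_c σ i)
theorem c_sq (i : Fin n) : (c i * c i : TrigDaHCa n u) = 1 := by
  simpa [e, ev, c, s] using mk_rel (.c_sq i)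
theorem c_c (i j : Fin n) (h : i ≠ j) : (c i * c j : TrigDaHCa n u) = -(c j * c i) := by
  simpa [e, ev, c, s] using mk_rel (.c_c i j h)

/-- The parity map: `cᵢ ↦ -cᵢ`, while `e^η`, `εᵢ^∨` and the permutations are fixed. -/
def parity (n : ℕ) (u : ℂ) : TrigDaHCa n u →ₐ[ℂ] TrigDaHCa n u :=
  RingQuot.liftAlgHom ℂ (s := TrigGen.Rel n u)
    ⟨FreeAlgebra.lift ℂ fun g => match g with
      | TrigGen.e η => e η
      | TrigGen.ev i => ev i
      | TrigGen.c i => -c i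
      | TrigGen.s σ => s σ, by
      intro a b h
      have h' := mk_rel h
      cases h <;>
        simpa [e, ev, c, s, neg_eq_iff_eq_neg, TrigGen.ofLaurent, map_finsuppSum] using h'⟩

theorem parity_e (η : WeightLattice n) : parity n u (e η) = e η :=
  (RingQuot.liftAlgHom_mkAlgHom_apply ℂ _ _ _).trans (FreeAlgebra.lift_ι_apply _ _)
theorem parity_ev (i : Fin n) : parity n u (ev i) = ev i :=
  (RingQuot.liftAlgHom_mkAlgHom_apply ℂ _ _ _).trans (FreeAlgebra.lift_ι_apply _ _)
theorem parity_c (i : Fin n) : parity n u (c i) = -c i :=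
  (RingQuot.liftAlgHom_mkAlgHom_apply ℂ _ _ _).trans (FreeAlgebra.lift_ι_apply _ _)
theorem parity_s (σ : Equiv.Perm (Fin n)) : parity n u (s σ) = s σ :=
  (RingQuot.liftAlgHom_mkAlgHom_apply ℂ _ _ _).trans (FreeAlgebra.lift_ι_apply _ _)

theorem algHom_ext {A : Type*} [Semiring A] [Algebra ℂ A] {f g : TrigDaHCa n u →ₐ[ℂ] A}
    (he : ∀ η, f (e η) = g (e η)) (hev : ∀ i, f (ev i) = g (ev i)) (hc : ∀ i, f (c i) = g (c i))
    (hs : ∀ σ, f (s σ) = g (s σ)) : f = g := by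
  refine RingQuot.ringQuot_ext' ℂ _ _ (FreeAlgebra.hom_ext (funext fun k => ?_))
  cases k with
  | e η => exact he η
  | ev i => exact hev i
  | c i => exact hc i
  | s σ => exact hs σ

theorem parity_parity (a : TrigDaHCa n u) : parity n u (parity n u a) = a := by
  have : (parity n u).comp (parity n u) = AlgHom.id ℂ _ :=
    algHom_ext (by simp [parity_e]) (by simp [parity_ev]) (by simp [parity_c]) (by simp [parity_s])
  exact DFunLike.congr_fun this a

/-- The superalgebra structure: the `cᵢ` are odd, the other generators are even. -/
abbrev grading (n : ℕ) (u : ℂ) : ZMod 2 → Submodule ℂ (TrigDaHCa n u) :=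
  parityGrading (parity n u)

instance : GradedAlgebra (grading n u) := parityGradedAlgebra _ parity_parity

/-- The canonical map from `𝒞ₙ ⋊ ℂSₙ`. -/
def ofCliffordPerm (n : ℕ) (u : ℂ) : CliffordPerm n →ₐ[ℂ] TrigDaHCa n u :=
  CliffordPerm.lift c s s_one s_mul c_sq c_c s_c

end TrigDaHCa

/-! ### The algebra `ℂ[y^±] ⊗_{ℂ[y]} Ḧᶜ` -/

/-- The polynomial ring `ℂ[y₁, …, yₙ]`. -/
abbrev PolyRing (n : ℕ) : Type := MvPolynomial (Fin n) ℂ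

/-- `ℂ[y^±]` is an algebra over `ℂ[y]`, through `yᵢ ↦ yᵢ`. -/
instance LaurentRing.algebraPoly (n : ℕ) : Algebra (PolyRing n) (LaurentRing n) :=
  (MvPolynomial.aeval fun i => LaurentRing.e (WeightLattice.eps i) :
    PolyRing n →ₐ[ℂ] LaurentRing n).toAlgebra

theorem LaurentRing.algebraMap_X {n : ℕ} (i : Fin n) :
    algebraMap (PolyRing n) (LaurentRing n) (MvPolynomial.X i) = e (WeightLattice.eps i) :=
  MvPolynomial.aeval_X _ _

instance (n : ℕ) : IsScalarTower ℂ (PolyRing n) (LaurentRing n) :=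
  IsScalarTower.of_algebraMap_eq fun t => by
    change _ = MvPolynomial.aeval _ _
    rw [AlgHom.map_algebraMap]

namespace RationalDaHCa

variable {n : ℕ} {u : ℂ}

/-- The subalgebra generated by the commuting elements `yᵢ`. -/
abbrev ySub (n : ℕ) (u : ℂ) : Subalgebra ℂ (RationalDaHCa n u) :=
  Algebra.adjoin ℂ (Set.range y)

instance (n : ℕ) (u : ℂ) : IsMulCommutative (ySub n u) :=
  Algebra.isMulCommutative_adjoin ℂ (by rintro _ ⟨i, rfl⟩ _ ⟨j, rfl⟩; exact y_y i j)

open scoped IsMulCommutative in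
/-- The algebra homomorphism `ℂ[y₁, …, yₙ] → Ḧᶜ`. -/
def poly (n : ℕ) (u : ℂ) : PolyRing n →ₐ[ℂ] RationalDaHCa n u :=
  (ySub n u).val.comp
    (MvPolynomial.aeval fun i => (⟨y i, Algebra.subset_adjoin ⟨i, rfl⟩⟩ : ySub n u))

open scoped IsMulCommutative in
theorem poly_X (i : Fin n) : poly n u (MvPolynomial.X i) = y i := by
  exact congrArg Subtype.val (MvPolynomial.aeval_X _ _)

/-- `Ḧᶜ` as a left module over `ℂ[y₁, …, yₙ]`. -/
instance : Module (PolyRing n) (RationalDaHCa n u) :=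
  Module.compHom _ (poly n u).toRingHom

theorem poly_smul (p : PolyRing n) (h : RationalDaHCa n u) : p • h = poly n u p * h := rfl

instance : IsScalarTower ℂ (PolyRing n) (RationalDaHCa n u) :=
  ⟨fun t p h => by rw [poly_smul, poly_smul, map_smul, smul_mul_assoc]⟩

open MvPolynomial in
theorem s_poly (σ : Equiv.Perm (Fin n)) (p : PolyRing n) :
    s σ * poly n u p = poly n u (rename σ p) * s σ := by
  induction p using MvPolynomial.induction_on with
  | C a => rw [rename_C, ← algebraMap_eq, AlgHom.commutes]; exact (Algebra.commutes a _).symm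
  | add p q hp hq => rw [map_add, mul_add, hp, hq, map_add, map_add, add_mul]
  | mul_X p i hp =>
    rw [map_mul, ← mul_assoc, hp, mul_assoc, poly_X, s_y, ← mul_assoc, map_mul, map_mul, rename_X,
      poly_X]

open MvPolynomial in
theorem c_poly (j : Fin n) (p : PolyRing n) : c j * poly n u p = poly n u p * c j := by
  induction p using MvPolynomial.induction_on with
  | C a => rw [← algebraMap_eq, AlgHom.commutes]; exact (Algebra.commutes a _).symm
  | add p q hp hq => rw [map_add, mul_add, hp, hq, add_mul]
  | mul_X p i hp =>
    rw [map_mul, ← mul_assoc, hp, mul_assoc, poly_X, c_y, ← mul_assoc]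

open MvPolynomial in
theorem twist_poly (i k : Fin n) (p : PolyRing n) :
    (u • ((1 + c k * c i) * s (Equiv.swap k i))) * poly n u p =
      poly n u (rename (Equiv.swap k i) p) * (u • ((1 + c k * c i) * s (Equiv.swap k i))) := by
  rw [smul_mul_assoc, mul_smul_comm]
  congr 1
  rw [mul_assoc, s_poly, ← mul_assoc, ← mul_assoc]
  congr 1
  rw [add_mul, one_mul, mul_add, mul_one, mul_assoc, c_poly, ← mul_assoc, c_poly, mul_assoc]

open MvPolynomial in
/-- The commutator of `xᵢ` with a polynomial in the `yᵢ` through divided differences. -/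
theorem exists_x_poly (i : Fin n) (p : PolyRing n) : ∃ g : Fin n → PolyRing n,
    (∀ k, (X i - X k) * g k = p - rename (Equiv.swap k i) p) ∧
      x i * poly n u p - poly n u p * x i =
        ∑ k with k ≠ i, poly n u (g k) * (u • ((1 + c k * c i) * s (Equiv.swap k i))) := by
  induction p using MvPolynomial.induction_on with
  | C a =>
    refine ⟨0, by simp, ?_⟩
    rw [← algebraMap_eq, AlgHom.commutes, Algebra.commutes a (x i)]
    simp
  | add p q hp hq =>
    obtain ⟨g, hg, hg'⟩ := hp
    obtain ⟨g', hq, hq'⟩ := hq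
    refine ⟨g + g', fun k => ?_, ?_⟩
    · rw [Pi.add_apply, mul_add, hg, hq, map_add]; ring
    · have e1 : x i * poly n u (p + q) - poly n u (p + q) * x i =
          (x i * poly n u p - poly n u p * x i) + (x i * poly n u q - poly n u q * x i) := by
        rw [map_add, mul_add, add_mul]; abel
      rw [e1, hg', hq', ← Finset.sum_add_distrib]
      refine Finset.sum_congr rfl fun k _ => ?_
      rw [Pi.add_apply, map_add, add_mul (poly n u (g k))]
  | mul_X p j hp =>
    obtain ⟨g, hg, hg'⟩ := hp
    have hX : ∃ g' : Fin n → PolyRing n,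
        (∀ k, (X i - X k) * g' k = X j - rename (Equiv.swap k i) (X j)) ∧
          x i * y j - y j * x i =
            ∑ k with k ≠ i, poly n u (g' k) * (u • ((1 + c k * c i) * s (Equiv.swap k i))) := by
      by_cases hij : i = j
      · subst hij
        refine ⟨1, fun k => by simp, ?_⟩
        rw [← neg_sub, y_x, neg_neg, Finset.smul_sum]
        simp
      · refine ⟨Pi.single j (-1), fun k => ?_, ?_⟩
        · rw [rename_X]
          by_cases hk : k = j
          · subst hk; simp
          · rw [Equiv.swap_apply_of_ne_of_ne (fun h => hk h.symm) (fun h => hij h.symm)]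
            simp [hk]
        · rw [Finset.sum_eq_single j]
          · rw [Pi.single_eq_same, map_neg, map_one, neg_one_mul, ← neg_sub, y_x_ne i j hij,
              Equiv.swap_comm]
          · intro k _ hk; simp [hk]
          · intro h; simp [Ne.symm hij] at h
    obtain ⟨g', hX, hX'⟩ := hX
    refine ⟨fun k => g k * rename (Equiv.swap k i) (X j) + p * g' k, fun k => ?_, ?_⟩
    · rw [mul_add, ← mul_assoc, hg, mul_left_comm, hX, map_mul]; ring
    · have e1 : x i * poly n u (p * X j) - poly n u (p * X j) * x i =
          (x i * poly n u p - poly n u p * x i) * y j +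
            poly n u p * (x i * y j - y j * x i) := by
        rw [map_mul, poly_X]; noncomm_ring
      rw [e1, hg', hX', Finset.sum_mul, Finset.mul_sum, ← Finset.sum_add_distrib]
      refine Finset.sum_congr rfl fun k _ => ?_
      rw [map_add, map_mul, map_mul, add_mul (poly n u (g k) * _)]
      congr 1
      · rw [mul_assoc, ← poly_X j, twist_poly, ← mul_assoc]
      · rw [mul_assoc]

/-- The element `y₁ ⋯ yₙ`, which is central in `Ḧᶜ`. -/
def yProd (n : ℕ) : PolyRing n := ∏ i, MvPolynomial.X i

open MvPolynomial in
theorem rename_yProd (σ : Equiv.Perm (Fin n)) : rename σ (yProd n) = yProd n := by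
  simp only [yProd, map_prod, rename_X]
  exact Equiv.prod_comp σ (fun i => (X i : PolyRing n))

theorem yProd_central (h : RationalDaHCa n u) :
    h * poly n u (yProd n) = poly n u (yProd n) * h := by
  have hx : ∀ i, x i * poly n u (yProd n) = poly n u (yProd n) * x i := by
    intro i
    obtain ⟨g, hg, hg'⟩ := exists_x_poly (u := u) i (yProd n)
    rw [← sub_eq_zero, hg']
    refine Finset.sum_eq_zero fun k hk => ?_
    have hki : k ≠ i := by simpa using hk
    have h1 := hg k
    rw [rename_yProd, sub_self] at h1
    have h2 : (MvPolynomial.X i - MvPolynomial.X k : PolyRing n) ≠ 0 := by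
      rw [sub_ne_zero]
      exact fun h => hki (MvPolynomial.X_injective h).symm
    rw [(mul_eq_zero.1 h1).resolve_left h2, map_zero, zero_mul]
  obtain ⟨a, rfl⟩ := mk_surjective h
  induction a using FreeAlgebra.induction with
  | grade0 r => rw [AlgHom.commutes]; exact Algebra.commutes r _
  | add a b ha hb => rw [map_add, add_mul, mul_add, ha, hb]
  | mul a b ha hb => rw [map_mul, mul_assoc, hb, ← mul_assoc, ha, mul_assoc]
  | grade1 g =>
    cases g with
    | x i => exact hx i
    | y i =>
      change y i * _ = _ * y i
      rw [← poly_X, ← map_mul, ← map_mul, mul_comm]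
    | c i => exact c_poly i _
    | s σ => exact (s_poly σ _).trans (by rw [rename_yProd]; rfl)

end RationalDaHCa

/-- The left `ℂ[y^±]`-module `ℂ[y^±] ⊗_{ℂ[y]} Ḧᶜ`. It carries the algebra structure for which
`ℂ[y^±]` and `Ḧᶜ` are subalgebras and `p ⊗ h = (p ⊗ 1) (1 ⊗ h)`, constructed below. -/
def LocalizedDaHCa (n : ℕ) (u : ℂ) : Type := LaurentRing n ⊗[PolyRing n] RationalDaHCa n u

namespace LocalizedDaHCa

variable {n : ℕ} {u : ℂ}

instance : AddCommGroup (LocalizedDaHCa n u) :=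
  inferInstanceAs (AddCommGroup (LaurentRing n ⊗[PolyRing n] RationalDaHCa n u))
instance : Module (LaurentRing n) (LocalizedDaHCa n u) :=
  inferInstanceAs (Module (LaurentRing n) (LaurentRing n ⊗[PolyRing n] RationalDaHCa n u))
instance : Module ℂ (LocalizedDaHCa n u) :=
  inferInstanceAs (Module ℂ (LaurentRing n ⊗[PolyRing n] RationalDaHCa n u))
instance : IsScalarTower ℂ (LaurentRing n) (LocalizedDaHCa n u) :=
  inferInstanceAs (IsScalarTower ℂ (LaurentRing n)
    (LaurentRing n ⊗[PolyRing n] RationalDaHCa n u))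

/-- The pure tensor `p ⊗ h`. -/
def tmul (p : LaurentRing n) (h : RationalDaHCa n u) : LocalizedDaHCa n u := p ⊗ₜ[PolyRing n] h

theorem induction_on {motive : LocalizedDaHCa n u → Prop} (z : LocalizedDaHCa n u)
    (zero : motive 0) (tmul : ∀ p h, motive (tmul p h))
    (add : ∀ a b, motive a → motive b → motive (a + b)) : motive z :=
  TensorProduct.induction_on z zero tmul add

theorem add_tmul (p q : LaurentRing n) (h : RationalDaHCa n u) :
    tmul (p + q) h = tmul p h + tmul q h := TensorProduct.add_tmul _ _ _

theorem tmul_add (p : LaurentRing n) (h k : RationalDaHCa n u) :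
    tmul p (h + k) = tmul p h + tmul p k := TensorProduct.tmul_add _ _ _

theorem smul_tmul (p q : LaurentRing n) (h : RationalDaHCa n u) :
    p • tmul q h = tmul (p * q) h := TensorProduct.smul_tmul' _ _ _

theorem tmul_poly_mul (p : LaurentRing n) (r : PolyRing n) (h : RationalDaHCa n u) :
    tmul p (RationalDaHCa.poly n u r * h) = tmul (p * algebraMap (PolyRing n) _ r) h := by
  rw [← RationalDaHCa.poly_smul, mul_comm, ← Algebra.smul_def]
  exact (TensorProduct.smul_tmul r p h).symm

/-- Right multiplication by an element of `Ḧᶜ`. -/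
def rmul (k : RationalDaHCa n u) : Module.End (LaurentRing n) (LocalizedDaHCa n u) :=
  TensorProduct.AlgebraTensorModule.lTensor (LaurentRing n) (LaurentRing n)
    ({ toFun := fun h => h * k
       map_add' := fun a b => add_mul a b k
       map_smul' := fun _ a => mul_assoc _ a k } :
      RationalDaHCa n u →ₗ[PolyRing n] RationalDaHCa n u)

theorem rmul_tmul (k : RationalDaHCa n u) (p : LaurentRing n) (h : RationalDaHCa n u) :
    rmul k (tmul p h) = tmul p (h * k) := rfl

theorem end_ext {f g : Module.End (LaurentRing n) (LocalizedDaHCa n u)}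
    (h : ∀ a, f (tmul 1 a) = g (tmul 1 a)) : f = g := by
  refine LinearMap.ext fun z => ?_
  induction z using induction_on with
  | zero => rw [map_zero, map_zero]
  | tmul p a => rw [← mul_one p, ← smul_tmul, map_smul, map_smul, h]
  | add a b ha hb => rw [map_add, map_add, ha, hb]

theorem rmul_mul (k l : RationalDaHCa n u) : rmul (k * l) = rmul l * rmul k :=
  end_ext fun a => by
    rw [Module.End.mul_apply, rmul_tmul, rmul_tmul, rmul_tmul, mul_assoc]

theorem rmul_add (k l : RationalDaHCa n u) : rmul (k + l) = rmul k + rmul l :=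
  end_ext fun a => by
    rw [LinearMap.add_apply, rmul_tmul, rmul_tmul, rmul_tmul, mul_add, tmul_add]

theorem rmul_one : rmul (1 : RationalDaHCa n u) = 1 :=
  end_ext fun a => by rw [rmul_tmul, mul_one]; rfl

/-- Right multiplication by a polynomial in the `yᵢ`. -/
def rpoly : PolyRing n →ₐ[ℂ] Module.End (LaurentRing n) (LocalizedDaHCa n u) where
  toFun r := rmul (RationalDaHCa.poly n u r)
  map_one' := by rw [map_one, rmul_one]
  map_mul' a b := by rw [mul_comm, map_mul, rmul_mul]
  map_zero' := by
    rw [map_zero]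
    exact end_ext fun a => by rw [rmul_tmul, mul_zero]; exact TensorProduct.tmul_zero _ _
  map_add' a b := by rw [map_add, rmul_add]
  commutes' t := by
    rw [AlgHom.commutes]
    refine end_ext fun a => ?_
    rw [rmul_tmul, ← Algebra.commutes, ← Algebra.smul_def]
    change tmul 1 (t • a) = t • tmul 1 a
    exact TensorProduct.tmul_smul _ _ _

theorem rpoly_apply (r : PolyRing n) :
    (rpoly r : Module.End (LaurentRing n) (LocalizedDaHCa n u)) =
      rmul (RationalDaHCa.poly n u r) := rfl

theorem isUnit_rpoly_X (i : Fin n) :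
    IsUnit (rpoly (MvPolynomial.X i) : Module.End (LaurentRing n) (LocalizedDaHCa n u)) := by
  have h1 : IsUnit (algebraMap (PolyRing n) (LaurentRing n) (RationalDaHCa.yProd n)) := by
    rw [RationalDaHCa.yProd, map_prod]
    refine Finset.prod_induction _ IsUnit (fun a b ha hb => ha.mul hb) isUnit_one fun j _ => ?_
    rw [LaurentRing.algebraMap_X]
    exact IsUnit.of_mul_eq_one (LaurentRing.e (-WeightLattice.eps j)) (by
      rw [← LaurentRing.e_add, add_neg_cancel, LaurentRing.e_zero])
  have h2 : (rpoly (RationalDaHCa.yProd n) :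
      Module.End (LaurentRing n) (LocalizedDaHCa n u)) =
      algebraMap (LaurentRing n) _ (algebraMap (PolyRing n) _ (RationalDaHCa.yProd n)) := by
    refine end_ext fun a => ?_
    rw [rpoly_apply, rmul_tmul, RationalDaHCa.yProd_central, tmul_poly_mul,
      Module.algebraMap_end_apply, smul_tmul, mul_comm]
  have h3 : IsUnit (rpoly (RationalDaHCa.yProd n) :
      Module.End (LaurentRing n) (LocalizedDaHCa n u)) := h2 ▸ h1.map _
  rw [RationalDaHCa.yProd, ← Finset.mul_prod_erase _ _ (Finset.mem_univ i), map_mul] at h3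
  refine ((Commute.isUnit_mul_iff ?_).1 h3).1
  exact (Commute.all _ _).map _

/-- Right multiplication by `yᵢ`, as an invertible operator. -/
def runit (i : Fin n) : (Module.End (LaurentRing n) (LocalizedDaHCa n u))ˣ :=
  (isUnit_rpoly_X i).unit

theorem runit_commute (i j : Fin n) :
    Commute (runit i : (Module.End (LaurentRing n) (LocalizedDaHCa n u))ˣ) (runit j) := by
  refine Units.ext ?_
  exact ((Commute.all _ _).map rpoly : Commute (rpoly (MvPolynomial.X i)) (rpoly (.X j)))

/-- Right multiplication by a Laurent monomial in the `yᵢ`. -/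
def rmonomial : Multiplicative (WeightLattice n) →*
    (Module.End (LaurentRing n) (LocalizedDaHCa n u))ˣ where
  toFun η := MonoidHom.noncommPiCoprod (N := fun _ : Fin n => Multiplicative ℤ)
    (fun i => zpowersHom _ (runit i))
    (fun i j _ _ _ => ((runit_commute i j).zpow_zpow _ _)) (fun i => .ofAdd (η.toAdd i))
  map_one' := map_one _
  map_mul' _ _ := map_mul _ _ _

theorem rmonomial_eps (i : Fin n) :
    (rmonomial (.ofAdd (WeightLattice.eps i)) :
      (Module.End (LaurentRing n) (LocalizedDaHCa n u))ˣ) = runit i := by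
  have h : (fun j => Multiplicative.ofAdd ((WeightLattice.eps i : WeightLattice n) j)) =
      Pi.mulSingle (M := fun _ : Fin n => Multiplicative ℤ) i (Multiplicative.ofAdd 1) := by
    funext j
    by_cases hj : j = i
    · subst hj; simp [WeightLattice.eps]
    · simp [WeightLattice.eps, hj]
  simp only [rmonomial, MonoidHom.coe_mk, OneHom.coe_mk, toAdd_ofAdd, h]
  refine (MonoidHom.noncommPiCoprod_mulSingle _ i _).trans ?_
  simp

/-- Right multiplication by a Laurent polynomial in the `yᵢ`. -/
def rlaurent : LaurentRing n →ₐ[ℂ] Module.End (LaurentRing n) (LocalizedDaHCa n u) :=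
  AddMonoidAlgebra.lift ℂ _ _ ((Units.coeHom _).comp rmonomial)

theorem rlaurent_e (η : WeightLattice n) :
    (rlaurent (LaurentRing.e η) : Module.End (LaurentRing n) (LocalizedDaHCa n u)) =
      ((rmonomial (.ofAdd η) : (Module.End (LaurentRing n) (LocalizedDaHCa n u))ˣ) :
        Module.End (LaurentRing n) (LocalizedDaHCa n u)) := by
  simp [rlaurent, LaurentRing.e, AddMonoidAlgebra.lift_single]

theorem rlaurent_algebraMap (r : PolyRing n) :
    (rlaurent (algebraMap _ _ r) : Module.End (LaurentRing n) (LocalizedDaHCa n u)) = rpoly r := by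
  have : (rlaurent.comp (IsScalarTower.toAlgHom ℂ (PolyRing n) (LaurentRing n)) :
      PolyRing n →ₐ[ℂ] Module.End (LaurentRing n) (LocalizedDaHCa n u)) = rpoly := by
    refine MvPolynomial.algHom_ext fun i => ?_
    rw [AlgHom.comp_apply, IsScalarTower.coe_toAlgHom', LaurentRing.algebraMap_X, rlaurent_e,
      rmonomial_eps]
    rfl
  exact DFunLike.congr_fun this r

theorem algebraMap_monomial (μ : Fin n → ℕ) :
    algebraMap (PolyRing n) (LaurentRing n) (∏ i, MvPolynomial.X i ^ μ i) =
      LaurentRing.e (fun i => (μ i : ℤ)) := by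
  have hpow : ∀ (β : WeightLattice n) (k : ℕ), LaurentRing.e (k • β) = LaurentRing.e β ^ k := by
    intro β k
    induction k with
    | zero => rw [zero_smul, pow_zero, LaurentRing.e_zero]
    | succ k ih => rw [add_smul, one_smul, LaurentRing.e_add, ih, pow_succ]
  have hsum : ∀ (s : Finset (Fin n)) (f : Fin n → WeightLattice n),
      LaurentRing.e (∑ i ∈ s, f i) = ∏ i ∈ s, LaurentRing.e (f i) := by
    intro s f
    induction s using Finset.cons_induction with
    | empty => rw [Finset.sum_empty, Finset.prod_empty, LaurentRing.e_zero]
    | cons a s ha ih => rw [Finset.sum_cons, Finset.prod_cons, LaurentRing.e_add, ih]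
  rw [map_prod]
  simp_rw [map_pow, LaurentRing.algebraMap_X, ← hpow]
  rw [← hsum]
  congr 1
  funext j
  simp [WeightLattice.eps, Finset.sum_apply, Pi.single_apply]

/-- Every Laurent polynomial becomes a polynomial after multiplication by a monomial. -/
theorem exists_denominator (q : LaurentRing n) :
    ∃ (η : WeightLattice n) (m r : PolyRing n),
      algebraMap _ _ m = LaurentRing.e η ∧ LaurentRing.e η * q = algebraMap _ _ r := by
  induction q using AddMonoidAlgebra.induction_linear with
  | zero => exact ⟨0, 1, 0, by rw [map_one, LaurentRing.e_zero], by rw [mul_zero, map_zero]⟩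
  | add p q hp hq =>
    obtain ⟨η, m, r, hm, hr⟩ := hp
    obtain ⟨η', m', r', hm', hr'⟩ := hq
    refine ⟨η + η', m * m', r * m' + m * r', by rw [map_mul, hm, hm', LaurentRing.e_add], ?_⟩
    rw [map_add, map_mul, map_mul, ← hr, ← hr', hm, hm', LaurentRing.e_add]
    ring
  | single η a =>
    refine ⟨_, _, MvPolynomial.C a * ∏ i, MvPolynomial.X i ^ (η i).toNat,
      algebraMap_monomial (fun i => (-η i).toNat), ?_⟩
    have h : (AddMonoidAlgebra.single η a : LaurentRing n) =
        algebraMap ℂ (LaurentRing n) a * LaurentRing.e η := by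
      rw [← Algebra.smul_def, LaurentRing.e, AddMonoidAlgebra.smul_single, smul_eq_mul, mul_one]
    rw [h, mul_left_comm, ← LaurentRing.e_add, map_mul, algebraMap_monomial,
      ← MvPolynomial.algebraMap_eq, ← IsScalarTower.algebraMap_apply]
    congr 2
    funext i
    simp only [Pi.add_apply]
    omega

/-- The operator of right multiplication by an element of `ℂ[y^±] ⊗_{ℂ[y]} Ḧᶜ`: first right
multiplication by the Laurent polynomial, then by the element of `Ḧᶜ`. -/
def rtensor : LocalizedDaHCa n u →+ Module.End (LaurentRing n) (LocalizedDaHCa n u) :=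
  TensorProduct.liftAddHom
    (AddMonoidHom.mk' (fun q => AddMonoidHom.mk' (fun k => rmul k * rlaurent q)
        (fun k l => by rw [rmul_add, add_mul]))
      (fun p q => AddMonoidHom.ext fun k => by
        simp [mul_add]))
    (fun r q k => by
      change rmul k * rlaurent (r • q) = rmul (r • k) * rlaurent q
      rw [Algebra.smul_def, map_mul, rlaurent_algebraMap, RationalDaHCa.poly_smul, rmul_mul,
        mul_assoc, rpoly_apply])

theorem rtensor_tmul (q : LaurentRing n) (k : RationalDaHCa n u) :
    rtensor (tmul q k) = rmul k * rlaurent q := rfl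

theorem rtensor_rmul (k : RationalDaHCa n u) (b : LocalizedDaHCa n u) :
    rtensor (rmul k b) = rmul k * rtensor b := by
  induction b using induction_on with
  | zero => rw [map_zero, map_zero, mul_zero]
  | tmul q l => rw [rmul_tmul, rtensor_tmul, rtensor_tmul, rmul_mul, mul_assoc]
  | add a b ha hb => rw [map_add, map_add, map_add, ha, hb, mul_add]

theorem rlaurent_e_mul (η θ : WeightLattice n) :
    (rlaurent (LaurentRing.e (η + θ)) : Module.End (LaurentRing n) (LocalizedDaHCa n u)) =
      rlaurent (LaurentRing.e η) * rlaurent (LaurentRing.e θ) := by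
  rw [LaurentRing.e_add, map_mul]

theorem rlaurent_one_tmul (q : LaurentRing n) :
    rlaurent q (tmul 1 1 : LocalizedDaHCa n u) = tmul q 1 := by
  obtain ⟨η, m, r, hm, hr⟩ := exists_denominator q
  have hpoly : ∀ r : PolyRing n, rlaurent (algebraMap _ _ r) (tmul 1 1 : LocalizedDaHCa n u) =
      tmul (algebraMap _ _ r) 1 := fun r => by
    rw [rlaurent_algebraMap, rpoly_apply, rmul_tmul, one_mul,
      ← mul_one (RationalDaHCa.poly n u r), tmul_poly_mul, one_mul]
  have h1 := hpoly r
  rw [← hr, mul_comm, map_mul, Module.End.mul_apply, ← hm, hpoly m, ← mul_one (algebraMap _ _ m),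
    ← smul_tmul, map_smul, hm, mul_comm, ← smul_tmul] at h1
  have h2 := congrArg (fun z => LaurentRing.e (-η) • z) h1
  simpa [smul_smul, ← LaurentRing.e_add, LaurentRing.e_zero] using h2

theorem rtensor_rlaurent (q : LaurentRing n) (b : LocalizedDaHCa n u) :
    rtensor (rlaurent q b) = rlaurent q * rtensor b := by
  obtain ⟨η, m, r, hm, hr⟩ := exists_denominator q
  have hpoly : ∀ (r : PolyRing n) (b : LocalizedDaHCa n u),
      rtensor (rlaurent (algebraMap _ _ r) b) = rlaurent (algebraMap _ _ r) * rtensor b :=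
    fun r b => by rw [rlaurent_algebraMap, rpoly_apply, rtensor_rmul]
  have h1 := hpoly r b
  rw [← hr, map_mul, Module.End.mul_apply, ← hm, hpoly m, hm] at h1
  have h2 := congrArg (fun z => rlaurent (LaurentRing.e (-η)) * z) h1
  simpa [← mul_assoc, ← map_mul, ← LaurentRing.e_add, LaurentRing.e_zero] using h2

theorem rtensor_rtensor (a b : LocalizedDaHCa n u) :
    rtensor (rtensor a b) = rtensor a * rtensor b := by
  induction a using induction_on with
  | zero => rw [map_zero, LinearMap.zero_apply, map_zero, zero_mul]
  | tmul q k =>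
    rw [rtensor_tmul, Module.End.mul_apply, rtensor_rmul, rtensor_rlaurent, mul_assoc]
  | add a a' ha ha' => rw [map_add, LinearMap.add_apply, map_add, ha, ha', add_mul]

/-- The product of `a` and `b` is the result of right multiplication by `b` on `a`. -/
instance : Ring (LocalizedDaHCa n u) :=
  { (inferInstance : AddCommGroup (LocalizedDaHCa n u)) with
    mul := fun a b => rtensor b a
    one := tmul 1 1
    mul_assoc := fun a b c => by
      change rtensor c (rtensor b a) = rtensor (rtensor c b) a
      rw [rtensor_rtensor, Module.End.mul_apply]
    one_mul := fun b => by
      change rtensor b (tmul 1 1) = b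
      induction b using induction_on with
      | zero => rw [map_zero, LinearMap.zero_apply]
      | tmul q k => rw [rtensor_tmul, Module.End.mul_apply, rlaurent_one_tmul, rmul_tmul, one_mul]
      | add a a' ha ha' => rw [map_add, LinearMap.add_apply, ha, ha']
    mul_one := fun a => by
      change rtensor (tmul 1 1) a = a
      rw [rtensor_tmul, rmul_one, map_one, mul_one, Module.End.one_apply]
    zero_mul := fun a => map_zero (rtensor a)
    mul_zero := fun a => by
      change rtensor 0 a = 0
      rw [map_zero, LinearMap.zero_apply]
    left_distrib := fun a b c => by
      change rtensor (b + c) a = rtensor b a + rtensor c a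
      rw [map_add, LinearMap.add_apply]
    right_distrib := fun a b c => map_add (rtensor c) a b }

theorem mul_def (a b : LocalizedDaHCa n u) : a * b = rtensor b a := rfl

theorem one_def : (1 : LocalizedDaHCa n u) = tmul 1 1 := rfl

theorem mul_tmul_one_left (p q : LaurentRing n) (h : RationalDaHCa n u) :
    tmul p 1 * tmul q h = tmul (p * q) h := by
  rw [← mul_one p, ← smul_tmul, mul_def, map_smul, ← mul_def, ← one_def, one_mul, smul_tmul,
    mul_one]

theorem tmul_mul_one_tmul (p : LaurentRing n) (h k : RationalDaHCa n u) :
    tmul p h * tmul 1 k = tmul p (h * k) := by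
  rw [mul_def, rtensor_tmul, map_one, mul_one, rmul_tmul]

theorem tmul_eq (p : LaurentRing n) (h : RationalDaHCa n u) :
    tmul p h = tmul p 1 * tmul 1 h := by
  rw [tmul_mul_one_tmul, one_mul]

theorem smul_mul (p : LaurentRing n) (a b : LocalizedDaHCa n u) : p • a * b = p • (a * b) :=
  map_smul (rtensor b) p a

instance : Algebra ℂ (LocalizedDaHCa n u) :=
  Algebra.ofModule
    (fun t a b => by
      rw [← algebraMap_smul (LaurentRing n) t a, smul_mul, algebraMap_smul])
    (fun t a b => by
      induction b using induction_on with
      | zero => rw [smul_zero, mul_zero, smul_zero]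
      | tmul q k =>
        have : t • tmul q k = tmul (t • q) k := rfl
        rw [this, mul_def, rtensor_tmul, map_smul, mul_smul_comm, mul_def, rtensor_tmul]
        rfl
      | add b b' hb hb' => rw [smul_add, mul_add, hb, hb', mul_add, smul_add])

/-- The inclusion `h ↦ 1 ⊗ h` of `Ḧᶜ`. -/
def ofRational (n : ℕ) (u : ℂ) : RationalDaHCa n u →ₐ[ℂ] LocalizedDaHCa n u where
  toFun h := tmul 1 h
  map_one' := rfl
  map_mul' a b := (tmul_mul_one_tmul 1 a b).symm
  map_zero' := TensorProduct.tmul_zero _ _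
  map_add' a b := tmul_add 1 a b
  commutes' t := by
    rw [Algebra.algebraMap_eq_smul_one, Algebra.algebraMap_eq_smul_one]
    exact TensorProduct.tmul_smul _ _ _

/-- The inclusion `p ↦ p ⊗ 1` of `ℂ[y^±]`. -/
def ofLaurent (n : ℕ) (u : ℂ) : LaurentRing n →ₐ[ℂ] LocalizedDaHCa n u where
  toFun p := tmul p 1
  map_one' := rfl
  map_mul' a b := (mul_tmul_one_left a b 1).symm
  map_zero' := TensorProduct.zero_tmul _ _
  map_add' a b := add_tmul a b 1
  commutes' t := by
    rw [Algebra.algebraMap_eq_smul_one, Algebra.algebraMap_eq_smul_one]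
    rfl

/-- The two inclusions agree on `ℂ[y]`. -/
theorem ofLaurent_algebraMap (r : PolyRing n) :
    ofLaurent n u (algebraMap (PolyRing n) (LaurentRing n) r) =
      ofRational n u (RationalDaHCa.poly n u r) := by
  change tmul _ 1 = tmul 1 _
  rw [← mul_one (RationalDaHCa.poly n u r), tmul_poly_mul, one_mul]

end LocalizedDaHCa

/-! ### The maps `ι` and `j` -/

open WeightLattice in
/-- The conditions on `ι : Ḧᶜ → Ḧᶜ_tr`: it extends the identity map of `𝒞ₙ ⋊ ℂSₙ`, and
`ι(yᵢ) = e^{εᵢ}`, `ι(xᵢ) = e^{-εᵢ} (εᵢ^∨ - u ∑_{k<i} (1 - cᵢ cₖ) s_{ki})`. -/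
structure IsRationalToTrig {n : ℕ} {u : ℂ} (ι : RationalDaHCa n u →ₐ[ℂ] TrigDaHCa n u) :
    Prop where
  extends_id : ι.comp (RationalDaHCa.ofCliffordPerm n u) = TrigDaHCa.ofCliffordPerm n u
  map_y (i : Fin n) : ι (RationalDaHCa.y i) = TrigDaHCa.e (eps i)
  map_x (i : Fin n) : ι (RationalDaHCa.x i) = TrigDaHCa.e (-eps i) *
    (TrigDaHCa.ev i - u • ∑ k with k < i,
      (1 - TrigDaHCa.c i * TrigDaHCa.c k) * TrigDaHCa.s (Equiv.swap k i))

open WeightLattice in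
/-- The conditions on `j : Ḧᶜ_tr → ℂ[y^±] ⊗_{ℂ[y]} Ḧᶜ`: it extends the identity map of `𝒞ₙ ⋊ ℂSₙ`,
and `j(e^{εᵢ}) = yᵢ`, `j(εᵢ^∨) = yᵢ xᵢ + u ∑_{k<i} (1 - cᵢ cₖ) s_{ki}`. -/
structure IsTrigToLocalized {n : ℕ} {u : ℂ} (j : TrigDaHCa n u →ₐ[ℂ] LocalizedDaHCa n u) :
    Prop where
  extends_id : j.comp (TrigDaHCa.ofCliffordPerm n u) =
    (LocalizedDaHCa.ofRational n u).comp (RationalDaHCa.ofCliffordPerm n u)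
  map_e (i : Fin n) : j (TrigDaHCa.e (eps i)) =
    LocalizedDaHCa.ofRational n u (RationalDaHCa.y i)
  map_ev (i : Fin n) : j (TrigDaHCa.ev i) = LocalizedDaHCa.ofRational n u
    (RationalDaHCa.y i * RationalDaHCa.x i + u • ∑ k with k < i,
      (1 - RationalDaHCa.c i * RationalDaHCa.c k) * RationalDaHCa.s (Equiv.swap k i))

end

/-!
Write `T i k = (1 - cᵢ cₖ) s_{ki}` and `Aᵢ = ∑_{k<i} T i k` for the Jucys-Murphy elements of
`𝒞ₙ ⋊ ℂSₙ`. The two algebras are related by the substitution `εᵢ^∨ = yᵢ xᵢ + u Aᵢ`, `e^{εᵢ} = yᵢ`, and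
both directions rest on one computation. Call elements `xᵢ`, `yᵢ`, `cᵢ`, `s σ` of an algebra a Dunkl
family if they satisfy all rational relations except for the commutativity of the `xᵢ`. Since the
`Aᵢ` commute with each other, a Dunkl family satisfies
`[yᵢ xᵢ + u Aᵢ, yⱼ xⱼ + u Aⱼ] = yᵢ yⱼ [xᵢ, xⱼ]` (`IsDunklFamily.commutator`).

In the trigonometric algebra, `e^{-εᵢ} (εᵢ^∨ - u Aᵢ)` and `e^{εᵢ}` form a Dunkl family
(`IsTrigFamily.isDunklFamily`). As the `εᵢ^∨` commute and the `e^{εᵢ}` are invertible, its `xᵢ` commute,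
which gives `ι`. In the localized algebra the `xᵢ` commute, hence so do the `yᵢ xᵢ + u Aᵢ`, and the
trigonometric relations hold (`LocalizedDaHCa.isTrigFamily`), which gives `j`; here the relation
between `εᵢ^∨` and `e^η` is an identity of twisted derivations in `η`, so that it is enough to check it
for `η = εⱼ`. The additive map `p ⊗ h ↦ p ι(h)` is inverse to `j`, because it intertwines right
multiplication by `j(t)` and by `t` for every generator `t`.

As `j ∘ ι` is the localization map `h ↦ 1 ⊗ h`, the injectivity of `ι` follows from the flatness of
the rational algebra `H` over `ℂ[y]`. For this no basis of `H` is needed. The algebra `H` acts on the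
free `ℂ[y]`-module `ℂ[y] ⊗ H` induced from the restriction of `H` itself: `xᵢ` acts by the Dunkl
operator `1 ⊗ xᵢ + ∑ₖ Δᵢₖ ⊗ u T i k` with the divided differences `Δᵢₖ`, the `yᵢ` and `cᵢ` act on one
factor each, and permutations act diagonally. These operators form a Dunkl family; the commutators of
the `xᵢ` commute with the `yₖ` (`IsDunklFamily.x_commutator_mul_y`) and kill `1 ⊗ H`, hence vanish. The
multiplication map `p ⊗ h ↦ p h` is `H`-linear, so it is a retraction of `h ↦ h (1 ⊗ 1)`. Thus `H` is a
direct summand of a free `ℂ[y]`-module.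
-/

noncomputable section

/-! ### Clifford families and Jucys-Murphy elements -/

section CliffordFamily

open Equiv (swap)

variable {n : ℕ} {A : Type*} [Ring A]

/-- Elements `cᵢ` and `s σ` of an algebra that satisfy the defining relations of `𝒞ₙ ⋊ ℂSₙ`. -/
structure IsCliffordFamily (c : Fin n → A) (s : Equiv.Perm (Fin n) → A) : Prop where
  s_one : s 1 = 1
  s_mul (σ τ) : s (σ * τ) = s σ * s τ
  c_sq (i) : c i * c i = 1
  c_c (i j) : i ≠ j → c i * c j = -(c j * c i)
  s_c (σ i) : s σ * c i = c (σ i) * s σ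

/-- The element `(1 - cᵢ cₖ) s_{ki}`. -/
def cliffordSwap (c : Fin n → A) (s : Equiv.Perm (Fin n) → A) (i k : Fin n) : A :=
  (1 - c i * c k) * s (swap k i)

/-- The Jucys-Murphy element `∑_{k<i} (1 - cᵢ cₖ) s_{ki}`. -/
def jucysMurphy (c : Fin n → A) (s : Equiv.Perm (Fin n) → A) (i : Fin n) : A :=
  ∑ k with k < i, cliffordSwap c s i k

/-- Commutation of `(1 - cᵢ cₖ) s_{ki}` with a family permuted by `Sₙ` that commutes with the
Clifford generators. -/
theorem cliffordSwap_mul_even {c : Fin n → A}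
    {s : Equiv.Perm (Fin n) → A} {y : Fin n → A}
    (s_y : ∀ σ i, s σ * y i = y (σ i) * s σ) (c_y : ∀ i j, c j * y i = y i * c j)
    (i k j : Fin n) :
    cliffordSwap c s i k * y j = y (swap k i j) * cliffordSwap c s i k := by
  rw [cliffordSwap, mul_assoc, s_y, ← mul_assoc, ← mul_assoc, sub_mul, mul_assoc (c i), c_y,
    ← mul_assoc, c_y, mul_assoc (y _), one_mul, ← mul_one_sub]

/-- The sum is extended to all `k ≠ i`, the terms with `k > i` being zero, to match the sums over all
`k ≠ i` in the defining relations. -/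
theorem jucysMurphy_mul_even_commutator_self {c : Fin n → A}
    {s : Equiv.Perm (Fin n) → A} {y : Fin n → A}
    (s_y : ∀ σ i, s σ * y i = y (σ i) * s σ) (c_y : ∀ i j, c j * y i = y i * c j) (i : Fin n) :
    jucysMurphy c s i * y i - y i * jucysMurphy c s i =
      ∑ k with k ≠ i, (y (min i k) - y i) * cliffordSwap c s i k := by
  rw [jucysMurphy, Finset.sum_mul, Finset.mul_sum, ← Finset.sum_sub_distrib]
  refine Finset.sum_subset_zero_on_sdiff ?_ ?_ ?_
  · intro k hk
    simp only [Finset.mem_filter, Finset.mem_univ, true_and] at *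
    exact hk.ne
  · intro k hk
    simp only [Finset.mem_sdiff, Finset.mem_filter, Finset.mem_univ, true_and, not_lt] at hk
    rw [min_eq_left hk.2, sub_self, zero_mul]
  · intro k hk
    have hk : k < i := by simpa using hk
    rw [cliffordSwap_mul_even s_y c_y, Equiv.swap_apply_right, ← sub_mul, min_eq_right hk.le]

theorem jucysMurphy_mul_even_commutator {c : Fin n → A}
    {s : Equiv.Perm (Fin n) → A} {y : Fin n → A}
    (s_y : ∀ σ i, s σ * y i = y (σ i) * s σ) (c_y : ∀ i j, c j * y i = y i * c j) {i j : Fin n}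
    (hij : i ≠ j) :
    jucysMurphy c s i * y j - y j * jucysMurphy c s i =
      (y i - y (min i j)) * cliffordSwap c s i j := by
  have hk : ∀ k, k ≠ j → cliffordSwap c s i k * y j - y j * cliffordSwap c s i k = 0 := by
    intro k hk
    rw [cliffordSwap_mul_even s_y c_y, Equiv.swap_apply_of_ne_of_ne hk.symm hij.symm, sub_self]
  rw [jucysMurphy, Finset.sum_mul, Finset.mul_sum, ← Finset.sum_sub_distrib]
  rcases lt_or_gt_of_ne hij with hlt | hlt
  · rw [min_eq_left hlt.le, sub_self, zero_mul]
    refine Finset.sum_eq_zero fun k hk' => hk k ?_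
    exact ((by simpa using hk' : k < i).trans hlt).ne
  · rw [min_eq_right hlt.le, Finset.sum_eq_single j (fun k _ => hk k) (by simp [hlt]),
      cliffordSwap_mul_even s_y c_y, Equiv.swap_apply_left, sub_mul]

namespace IsCliffordFamily

variable {c : Fin n → A} {s : Equiv.Perm (Fin n) → A}

theorem s_swap_mul_self (h : IsCliffordFamily c s) (i k : Fin n) :
    s (swap i k) * s (swap i k) = 1 := by
  rw [← h.s_mul, Equiv.swap_mul_self, h.s_one]

/-- The other form of `(1 - cᵢ cₖ) s_{ki}`, with the Clifford generators interchanged. -/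
theorem cliffordSwap_eq (h : IsCliffordFamily c s) {i k : Fin n} (hik : i ≠ k) :
    cliffordSwap c s i k = (1 + c k * c i) * s (swap k i) := by
  rw [cliffordSwap, h.c_c i k hik, sub_neg_eq_add]

theorem s_mul_cliffordSwap (h : IsCliffordFamily c s) (σ : Equiv.Perm (Fin n)) (i k : Fin n) :
    s σ * cliffordSwap c s i k = cliffordSwap c s (σ i) (σ k) * s σ := by
  have e1 : s σ * (1 - c i * c k) = (1 - c (σ i) * c (σ k)) * s σ := by
    rw [mul_sub, sub_mul, ← mul_assoc, h.s_c, mul_assoc, h.s_c, mul_assoc, mul_one, one_mul]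
  rw [cliffordSwap, ← mul_assoc, e1, mul_assoc, ← h.s_mul, cliffordSwap, mul_assoc, ← h.s_mul,
    Equiv.mul_swap_eq_swap_mul]

theorem c_mul_cliffordSwap_self (h : IsCliffordFamily c s) (i k : Fin n) :
    c i * cliffordSwap c s i k = -(cliffordSwap c s i k * c i) := by
  rw [cliffordSwap, mul_assoc, h.s_c, Equiv.swap_apply_right, ← mul_assoc, ← mul_assoc, ← neg_mul]
  congr 1
  rw [mul_sub, sub_mul, mul_assoc, h.c_sq, ← mul_assoc, h.c_sq]
  simp

theorem c_mul_cliffordSwap (h : IsCliffordFamily c s) {i j k : Fin n} (hik : i ≠ k) (hj : j ≠ i) :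
    c j * cliffordSwap c s i k = cliffordSwap c s i k * c j := by
  rw [cliffordSwap, mul_assoc, h.s_c, ← mul_assoc, ← mul_assoc]
  congr 1
  by_cases hjk : j = k
  · subst hjk
    rw [Equiv.swap_apply_left, mul_sub, sub_mul, ← mul_assoc, h.c_c j i hj, neg_mul, mul_assoc,
      h.c_sq, mul_assoc, h.c_c j i hj, mul_neg, ← mul_assoc, h.c_sq]
    simp [add_comm]
  · rw [Equiv.swap_apply_of_ne_of_ne hjk hj, mul_sub, sub_mul, ← mul_assoc, h.c_c j i hj, neg_mul,
      mul_assoc, h.c_c j k hjk, mul_neg, neg_neg, mul_one, one_mul, mul_assoc]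

/-- Moving `(1 - cᵢ cₖ) s_{ki}` past `(1 - cⱼ cₗ) s_{lj}` permutes the index `l`. -/
theorem cliffordSwap_mul_cliffordSwap (h : IsCliffordFamily c s) {i j k l : Fin n} (hi : i ≠ j)
    (hk : k ≠ j) (hl : l ≠ j) :
    cliffordSwap c s i k * cliffordSwap c s j l =
      cliffordSwap c s j (swap k i l) * cliffordSwap c s i k := by
  have hj : swap k i j = j := Equiv.swap_apply_of_ne_of_ne hk.symm hi.symm
  have hl' : j ≠ swap k i l := by
    intro h'
    rw [← hj] at h'
    exact hl ((swap k i).injective h').symm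
  have hc : c i * c k * cliffordSwap c s j (swap k i l) =
      cliffordSwap c s j (swap k i l) * (c i * c k) := by
    rw [mul_assoc, h.c_mul_cliffordSwap hl' hk, ← mul_assoc, h.c_mul_cliffordSwap hl' hi, mul_assoc]
  rw [cliffordSwap, mul_assoc, h.s_mul_cliffordSwap, hj, ← mul_assoc, sub_mul, hc, one_mul,
    ← mul_one_sub, mul_assoc]

theorem cliffordSwap_mul_jucysMurphy (h : IsCliffordFamily c s) {i j k : Fin n} (hi : i < j)
    (hk : k < j) :
    cliffordSwap c s i k * jucysMurphy c s j = jucysMurphy c s j * cliffordSwap c s i k := by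
  rw [jucysMurphy, Finset.mul_sum, Finset.sum_mul]
  refine Finset.sum_equiv (swap k i) (fun l => ?_) (fun l hl => ?_)
  · simp only [Finset.mem_filter, Finset.mem_univ, true_and, Equiv.swap_apply_def]
    split_ifs <;> simp_all
  · exact h.cliffordSwap_mul_cliffordSwap hi.ne hk.ne (by simpa using hl : l < j).ne

/-- The Jucys-Murphy elements commute. -/
theorem jucysMurphy_mul_jucysMurphy (h : IsCliffordFamily c s) {i j : Fin n} (hij : i < j) :
    jucysMurphy c s i * jucysMurphy c s j = jucysMurphy c s j * jucysMurphy c s i := by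
  rw [jucysMurphy.eq_1 c s i, Finset.mul_sum, Finset.sum_mul]
  refine Finset.sum_congr rfl fun k hk => ?_
  exact h.cliffordSwap_mul_jucysMurphy hij ((by simpa using hk : k < i).trans hij)

theorem c_mul_jucysMurphy_self (h : IsCliffordFamily c s) (i : Fin n) :
    c i * jucysMurphy c s i = -(jucysMurphy c s i * c i) := by
  rw [jucysMurphy, Finset.mul_sum, Finset.sum_mul, ← Finset.sum_neg_distrib]
  exact Finset.sum_congr rfl fun k _ => h.c_mul_cliffordSwap_self i k

theorem c_mul_jucysMurphy (h : IsCliffordFamily c s) {i j : Fin n} (hj : j ≠ i) :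
    c j * jucysMurphy c s i = jucysMurphy c s i * c j := by
  rw [jucysMurphy, Finset.mul_sum, Finset.sum_mul]
  refine Finset.sum_congr rfl fun k hk => ?_
  exact h.c_mul_cliffordSwap (by simpa using hk : k < i).ne' hj

/-- Conjugating the Jucys-Murphy element of index `i` by the transposition of `i` and `j = i + 1`
gives all terms of the Jucys-Murphy element of index `j` but one. -/
theorem jucysMurphy_mul_s_adjacent (h : IsCliffordFamily c s) {i j : Fin n}
    (hij : (j : ℕ) = i + 1) :
    jucysMurphy c s j * s (swap i j) - s (swap i j) * jucysMurphy c s i = 1 - c j * c i := by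
  have hlt : i < j := Fin.lt_def.2 (by omega)
  have hset : (Finset.univ.filter fun k => k < j) =
      Finset.cons i (Finset.univ.filter fun k => k < i) (by simp) := by
    ext k
    simp only [Finset.mem_filter, Finset.mem_univ, true_and, Finset.mem_cons, Fin.lt_def,
      Fin.ext_iff]
    omega
  have hlast : cliffordSwap c s j i * s (swap i j) = 1 - c j * c i := by
    rw [cliffordSwap, mul_assoc, h.s_swap_mul_self, mul_one]
  rw [jucysMurphy, hset, Finset.sum_cons, add_mul, hlast, add_sub_assoc, add_eq_left, sub_eq_zero,
    jucysMurphy, Finset.mul_sum, Finset.sum_mul]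
  refine Finset.sum_congr rfl fun k hk => ?_
  have hk : k < i := by simpa using hk
  rw [h.s_mul_cliffordSwap, Equiv.swap_apply_left, Equiv.swap_apply_of_ne_of_ne hk.ne
    (hk.trans hlt).ne]

theorem jucysMurphy_mul_s_adjacent_ne (h : IsCliffordFamily c s) {i j k : Fin n}
    (hij : (j : ℕ) = i + 1) (hi : k ≠ i) (hj : k ≠ j) :
    jucysMurphy c s k * s (swap i j) = s (swap i j) * jucysMurphy c s k := by
  rw [jucysMurphy, Finset.mul_sum, Finset.sum_mul]
  refine Finset.sum_equiv (swap i j) (fun l => ?_) (fun l _ => ?_)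
  · simp only [Finset.mem_filter, Finset.mem_univ, true_and, Equiv.swap_apply_def, Fin.lt_def,
      Fin.ext_iff] at *
    split_ifs <;> omega
  · rw [h.s_mul_cliffordSwap, Equiv.swap_apply_of_ne_of_ne hi hj, Equiv.swap_apply_self]

end IsCliffordFamily

end CliffordFamily

/-! ### Dunkl families -/

section DunklFamily

open Equiv (swap)

variable {n : ℕ} {A : Type*} [Ring A] [Algebra ℂ A]

/-- Elements of an algebra that satisfy all defining relations of the rational double affine
Hecke-Clifford algebra except possibly for the commutativity of the `xᵢ`. -/
structure IsDunklFamily (u : ℂ) (x y c : Fin n → A) (s : Equiv.Perm (Fin n) → A) : Prop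
    extends IsCliffordFamily c s where
  y_y (i j) : y i * y j = y j * y i
  s_x (σ i) : s σ * x i = x (σ i) * s σ
  s_y (σ i) : s σ * y i = y (σ i) * s σ
  c_x (i) : c i * x i = -(x i * c i)
  c_x_ne (i j) : i ≠ j → c j * x i = x i * c j
  c_y (i j) : c j * y i = y i * c j
  x_y_ne (i j) : i ≠ j → x i * y j - y j * x i = -(u • cliffordSwap c s i j)
  x_y (i) : x i * y i - y i * x i = u • ∑ k with k ≠ i, cliffordSwap c s i k

namespace IsDunklFamily

variable {u : ℂ} {x y c : Fin n → A} {s : Equiv.Perm (Fin n) → A}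

theorem cliffordSwap_mul_x_of_ne (h : IsDunklFamily u x y c s) {i j k : Fin n} (hi : j ≠ i)
    (hk : j ≠ k) : cliffordSwap c s i k * x j = x j * cliffordSwap c s i k := by
  rw [cliffordSwap, mul_assoc, h.s_x, Equiv.swap_apply_of_ne_of_ne hk hi, ← mul_assoc, ← mul_assoc]
  congr 1
  rw [sub_mul, mul_assoc, h.c_x_ne j k hk, ← mul_assoc, h.c_x_ne j i hi, mul_assoc, one_mul,
    ← mul_one_sub]

/-- As `xᵢ` anticommutes with `cᵢ`, moving it past the transposition of `i` and `j` interchanges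
the Clifford generators. -/
theorem x_mul_cliffordSwap (h : IsDunklFamily u x y c s) {i j : Fin n} (hij : i ≠ j) :
    x i * cliffordSwap c s j i = cliffordSwap c s i j * x j := by
  rw [cliffordSwap, cliffordSwap, mul_assoc (_ - _), h.s_x, Equiv.swap_apply_left,
    Equiv.swap_comm j i, ← mul_assoc, ← mul_assoc]
  congr 1
  rw [mul_sub, sub_mul, mul_assoc (c i), h.c_x_ne i j hij, ← mul_assoc (c i), h.c_x, h.c_c j i
    hij.symm]
  noncomm_ring

theorem commutator_of_lt (h : IsDunklFamily u x y c s) {i j : Fin n} (hij : i < j) :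
    (y i * x i + u • jucysMurphy c s i) * (y j * x j + u • jucysMurphy c s j) -
      (y j * x j + u • jucysMurphy c s j) * (y i * x i + u • jucysMurphy c s i) =
      y i * y j * (x i * x j - x j * x i) := by
  have hne := hij.ne
  have hsx := h.toIsCliffordFamily
  -- every term of the Jucys-Murphy element of index `j` commutes with `yᵢ xᵢ`, except the `i`-th
  have h1 : jucysMurphy c s j * (y i * x i) - y i * x i * jucysMurphy c s j =
      y j * (cliffordSwap c s j i * x i) - y i * (cliffordSwap c s i j * x j) := by
    rw [jucysMurphy, Finset.sum_mul, Finset.mul_sum, ← Finset.sum_sub_distrib,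
      Finset.sum_eq_single i]
    · rw [← mul_assoc, cliffordSwap_mul_even h.s_y h.c_y, Equiv.swap_apply_left, mul_assoc,
        mul_assoc, h.x_mul_cliffordSwap hne]
    · intro k hk hki
      have hk : k < j := by simpa using hk
      rw [← mul_assoc, cliffordSwap_mul_even h.s_y h.c_y,
        Equiv.swap_apply_of_ne_of_ne hki.symm hne, mul_assoc,
        h.cliffordSwap_mul_x_of_ne hne hki.symm, mul_assoc, sub_self]
    · simp [hij]
  have h2 : jucysMurphy c s i * (y j * x j) = y j * x j * jucysMurphy c s i := by
    rw [jucysMurphy, Finset.sum_mul, Finset.mul_sum]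
    refine Finset.sum_congr rfl fun k hk => ?_
    have hk : k < j := (by simpa using hk : k < i).trans hij
    rw [← mul_assoc, cliffordSwap_mul_even h.s_y h.c_y,
        Equiv.swap_apply_of_ne_of_ne hk.ne' hij.ne', mul_assoc,
        h.cliffordSwap_mul_x_of_ne hij.ne' hk.ne', mul_assoc]
  have h3 := h.jucysMurphy_mul_jucysMurphy hij
  have h4 : x i * y j = y j * x i - u • cliffordSwap c s i j := by
    rw [sub_eq_add_neg, ← h.x_y_ne i j hne]; abel
  have h5 : x j * y i = y i * x j - u • cliffordSwap c s j i := by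
    rw [sub_eq_add_neg, ← h.x_y_ne j i hne.symm]; abel
  have h6 : y i * x i * (y j * x j) - y j * x j * (y i * x i) =
      y i * y j * (x i * x j - x j * x i) + u • (y j * (cliffordSwap c s j i * x i) -
        y i * (cliffordSwap c s i j * x j)) := by
    rw [mul_assoc, ← mul_assoc (x i), h4, mul_assoc (y j), ← mul_assoc (x j), h5]
    simp only [sub_mul, mul_sub, smul_mul_assoc, mul_smul_comm, smul_sub, ← mul_assoc, h.y_y j i]
    abel
  rw [← h1] at h6
  rw [add_mul, mul_add, mul_add, add_mul, mul_add, mul_add]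
  simp only [smul_mul_assoc, mul_smul_comm, smul_sub, h2, h3] at h6 ⊢
  rw [← sub_eq_zero] at h6 ⊢
  rw [← h6]
  abel

/-- The commutators of the elements `yᵢ xᵢ + u ∑_{k<i} (1 - cᵢ cₖ) s_{ki}` reduce to those of the
`xᵢ`. -/
theorem commutator (h : IsDunklFamily u x y c s) (i j : Fin n) :
    (y i * x i + u • jucysMurphy c s i) * (y j * x j + u • jucysMurphy c s j) -
      (y j * x j + u • jucysMurphy c s j) * (y i * x i + u • jucysMurphy c s i) =
      y i * y j * (x i * x j - x j * x i) := by
  rcases lt_trichotomy i j with hij | rfl | hij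
  · exact h.commutator_of_lt hij
  · simp
  · rw [← neg_sub, h.commutator_of_lt hij, h.y_y i j, ← mul_neg, neg_sub]

/-- The commutators of the `xᵢ` commute with the `yₖ`, by the Jacobi identity. -/
theorem x_commutator_mul_y (h : IsDunklFamily u x y c s) (i j k : Fin n) :
    (x i * x j - x j * x i) * y k = y k * (x i * x j - x j * x i) := by
  have key : ∀ i j, i ≠ j → (x i * x j - x j * x i) * y i = y i * (x i * x j - x j * x i) := by
    intro i j hij
    have h1 : x i * y i = y i * x i + u • ∑ k with k ≠ i, cliffordSwap c s i k := by
      rw [← h.x_y]; abel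
    have h2 : x j * y i = y i * x j - u • cliffordSwap c s j i := by
      rw [sub_eq_add_neg, ← h.x_y_ne j i hij.symm]; abel
    have h3 : (∑ k with k ≠ i, cliffordSwap c s i k) * x j -
        x j * ∑ k with k ≠ i, cliffordSwap c s i k =
        cliffordSwap c s i j * x j - x j * cliffordSwap c s i j := by
      rw [Finset.sum_mul, Finset.mul_sum, ← Finset.sum_sub_distrib, Finset.sum_eq_single j]
      · intro k hk hkj
        rw [h.cliffordSwap_mul_x_of_ne hij.symm hkj.symm, sub_self]
      · simp [hij.symm]
    have h4 := h.x_mul_cliffordSwap hij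
    have h5 := h.x_mul_cliffordSwap hij.symm
    rw [sub_mul, mul_assoc, h2, mul_assoc, h1, mul_sub, mul_add, ← mul_assoc, h1, ← mul_assoc, h2]
    simp only [sub_mul, mul_sub, add_mul, smul_mul_assoc, mul_smul_comm, h4, ← h5, mul_assoc]
    rw [← sub_eq_zero, ← smul_zero u, ← sub_eq_zero.2 h3]
    simp only [smul_sub]
    abel
  by_cases hij : i = j
  · simp [hij]
  by_cases hki : k = i
  · rw [hki, key i j hij]
  by_cases hkj : k = j
  · rw [hkj, ← neg_sub, neg_mul, key j i (Ne.symm hij), mul_neg]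
  have h1 : x i * y k = y k * x i - u • cliffordSwap c s i k := by
    rw [sub_eq_add_neg, ← h.x_y_ne i k (Ne.symm hki)]; abel
  have h2 : x j * y k = y k * x j - u • cliffordSwap c s j k := by
    rw [sub_eq_add_neg, ← h.x_y_ne j k (Ne.symm hkj)]; abel
  have h3 := h.cliffordSwap_mul_x_of_ne (Ne.symm hij) (Ne.symm hkj) (i := i) (k := k)
  have h4 := h.cliffordSwap_mul_x_of_ne hij (Ne.symm hki) (i := j) (k := k)
  rw [sub_mul, mul_assoc, h2, mul_assoc, h1, mul_sub, mul_sub, ← mul_assoc, h1, ← mul_assoc, h2]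
  simp only [sub_mul, mul_sub, smul_mul_assoc, mul_smul_comm, h3, h4, mul_assoc]
  abel

/-- The commutator of `yᵢ xᵢ + u ∑_{k<i} (1 - cᵢ cₖ) s_{ki}` and `yᵢ`. -/
theorem euler_y_commutator_self (h : IsDunklFamily u x y c s) (i : Fin n) :
    (y i * x i + u • jucysMurphy c s i) * y i - y i * (y i * x i + u • jucysMurphy c s i) =
      u • ∑ k with k ≠ i, y (min i k) * cliffordSwap c s i k := by
  have h1 := jucysMurphy_mul_even_commutator_self h.s_y h.c_y i
  have h2 : (y i * x i + u • jucysMurphy c s i) * y i -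
      y i * (y i * x i + u • jucysMurphy c s i) = y i * (x i * y i - y i * x i) +
        u • (jucysMurphy c s i * y i - y i * jucysMurphy c s i) := by
    simp only [add_mul, mul_add, mul_sub, smul_sub, smul_mul_assoc, mul_smul_comm, mul_assoc]
    abel
  rw [h2, h1, h.x_y, mul_smul_comm, ← smul_add, Finset.mul_sum, ← Finset.sum_add_distrib]
  simp only [← add_mul, add_sub_cancel]

/-- The commutator of `yᵢ xᵢ + u ∑_{k<i} (1 - cᵢ cₖ) s_{ki}` and `yⱼ`, for `i ≠ j`. -/
theorem euler_y_commutator (h : IsDunklFamily u x y c s) {i j : Fin n} (hij : i ≠ j) :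
    (y i * x i + u • jucysMurphy c s i) * y j - y j * (y i * x i + u • jucysMurphy c s i) =
      -(u • (y (min i j) * cliffordSwap c s i j)) := by
  have h1 := jucysMurphy_mul_even_commutator h.s_y h.c_y hij
  have h2 : (y i * x i + u • jucysMurphy c s i) * y j -
      y j * (y i * x i + u • jucysMurphy c s i) = y i * (x i * y j - y j * x i) +
        u • (jucysMurphy c s i * y j - y j * jucysMurphy c s i) := by
    simp only [add_mul, mul_add, mul_sub, smul_sub, smul_mul_assoc, mul_smul_comm, ← mul_assoc,
      h.y_y j i]
    abel
  rw [h2, h1, h.x_y_ne i j hij, mul_neg, mul_smul_comm, sub_mul, smul_sub]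
  abel

end IsDunklFamily

end DunklFamily

namespace CliffordPerm

variable {n : ℕ} {A : Type} [Ring A] [Algebra ℂ A]

theorem lift_c (C : Fin n → A) (S : Equiv.Perm (Fin n) → A) (h1 h2 h3 h4 h5) (i : Fin n) :
    lift C S h1 h2 h3 h4 h5 (c i) = C i :=
  (RingQuot.liftAlgHom_mkAlgHom_apply ℂ _ _ _).trans (FreeAlgebra.lift_ι_apply _ _)

theorem lift_s (C : Fin n → A) (S : Equiv.Perm (Fin n) → A) (h1 h2 h3 h4 h5)
    (σ : Equiv.Perm (Fin n)) : lift C S h1 h2 h3 h4 h5 (s σ) = S σ :=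
  (RingQuot.liftAlgHom_mkAlgHom_apply ℂ _ _ _).trans (FreeAlgebra.lift_ι_apply _ _)

theorem algHom_ext {f g : CliffordPerm n →ₐ[ℂ] A} (hc : ∀ i, f (c i) = g (c i))
    (hs : ∀ σ, f (s σ) = g (s σ)) : f = g := by
  refine RingQuot.ringQuot_ext' ℂ _ _ (FreeAlgebra.hom_ext (funext fun k => ?_))
  cases k with
  | c i => exact hc i
  | s σ => exact hs σ

end CliffordPerm

namespace RationalDaHCa

variable {n : ℕ} {u : ℂ}

theorem ofCliffordPerm_c (i : Fin n) : ofCliffordPerm n u (CliffordPerm.c i) = c i :=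
  CliffordPerm.lift_c _ _ _ _ _ _ _ i

theorem ofCliffordPerm_s (σ : Equiv.Perm (Fin n)) : ofCliffordPerm n u (CliffordPerm.s σ) = s σ :=
  CliffordPerm.lift_s _ _ _ _ _ _ _ σ

theorem isCliffordFamily : IsCliffordFamily (c : Fin n → RationalDaHCa n u) s where
  s_one := s_one
  s_mul := s_mul
  c_sq := c_sq
  c_c := c_c
  s_c := s_c

theorem x_x (i j : Fin n) : (x i * x j : RationalDaHCa n u) = x j * x i := by
  simpa [x] using mk_rel (.x_x i j)

theorem isDunklFamily :
    IsDunklFamily u (x : Fin n → RationalDaHCa n u) y c s where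
  toIsCliffordFamily := isCliffordFamily
  y_y := y_y
  s_x σ i := by simpa [x, s] using mk_rel (.s_x σ i)
  s_y := s_y
  c_x i := by simpa [x, c] using mk_rel (.c_x i)
  c_x_ne i j hij := by simpa [x, c] using mk_rel (.c_x_ne i j hij)
  c_y := c_y
  x_y_ne i j hij := by
    rw [← neg_sub, y_x_ne i j hij, isCliffordFamily.cliffordSwap_eq hij, Equiv.swap_comm]
  x_y i := by
    rw [← neg_sub, y_x, neg_neg]
    congr 1
    refine Finset.sum_congr rfl fun k hk => ?_
    rw [isCliffordFamily.cliffordSwap_eq (by simpa using hk : k ≠ i).symm]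

/-- The algebra homomorphism given by a Dunkl family with commuting `xᵢ`. -/
def lift {A : Type*} [Ring A] [Algebra ℂ A] {X Y C : Fin n → A} {S : Equiv.Perm (Fin n) → A}
    (h : IsDunklFamily u X Y C S) (hX : ∀ i j, X i * X j = X j * X i) :
    RationalDaHCa n u →ₐ[ℂ] A :=
  RingQuot.liftAlgHom ℂ (s := RationalGen.Rel n u)
    ⟨FreeAlgebra.lift ℂ fun g => match g with
      | RationalGen.x i => X i
      | RationalGen.y i => Y i
      | RationalGen.c i => C i
      | RationalGen.s σ => S σ, by
      intro a b hab
      cases hab <;> simp only [map_mul, map_one, map_neg, map_sub, map_smul, map_add, map_sum,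
        FreeAlgebra.lift_ι_apply]
      case s_one => exact h.s_one
      case s_mul => exact h.s_mul _ _
      case x_x => exact hX _ _
      case y_y => exact h.y_y _ _
      case s_x => exact h.s_x _ _
      case s_y => exact h.s_y _ _
      case c_x => exact h.c_x _
      case c_y => exact h.c_y _ _
      case c_x_ne hij => exact h.c_x_ne _ _ hij
      case c_y_ne => exact h.c_y _ _
      case s_c => exact h.s_c _ _
      case c_sq => exact h.c_sq _
      case c_c hij => exact h.c_c _ _ hij
      case y_x_ne i j hij =>
        rw [← neg_sub, h.x_y_ne i j hij, neg_neg, h.cliffordSwap_eq hij, Equiv.swap_comm]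
      case y_x i =>
        rw [← neg_sub, h.x_y]
        congr 2
        refine Finset.sum_congr rfl fun k hk => ?_
        rw [h.cliffordSwap_eq (by simpa using hk : k ≠ i).symm]⟩

section lift

variable {A : Type*} [Ring A] [Algebra ℂ A] {X Y C : Fin n → A} {S : Equiv.Perm (Fin n) → A}
    (h : IsDunklFamily u X Y C S) (hX : ∀ i j, X i * X j = X j * X i)

theorem lift_x (i : Fin n) : lift h hX (x i) = X i :=
  (RingQuot.liftAlgHom_mkAlgHom_apply ℂ _ _ _).trans (FreeAlgebra.lift_ι_apply _ _)

theorem lift_y (i : Fin n) : lift h hX (y i) = Y i :=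
  (RingQuot.liftAlgHom_mkAlgHom_apply ℂ _ _ _).trans (FreeAlgebra.lift_ι_apply _ _)

theorem lift_c (i : Fin n) : lift h hX (c i) = C i :=
  (RingQuot.liftAlgHom_mkAlgHom_apply ℂ _ _ _).trans (FreeAlgebra.lift_ι_apply _ _)

theorem lift_s (σ : Equiv.Perm (Fin n)) : lift h hX (s σ) = S σ :=
  (RingQuot.liftAlgHom_mkAlgHom_apply ℂ _ _ _).trans (FreeAlgebra.lift_ι_apply _ _)

end lift

end RationalDaHCa

/-! ### Divided differences of Laurent monomials -/

namespace WeightLattice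

variable {n : ℕ}

theorem act_add (σ : Equiv.Perm (Fin n)) (η θ : WeightLattice n) :
    act σ (η + θ) = act σ η + act σ θ := rfl

theorem eps_injective : Function.Injective (eps : Fin n → WeightLattice n) := by
  intro i j h
  by_contra hij
  have := congrFun h i
  simp [eps, hij] at this

/-- The weight lattice is generated by the `εᵢ`. -/
theorem induction_eps {p : WeightLattice n → Prop} (eps : ∀ i, p (eps i)) (zero : p 0)
    (add : ∀ η θ, p η → p θ → p (η + θ)) (neg : ∀ η, p η → p (-η)) (η : WeightLattice n) : p η := by
  let S : AddSubgroup (WeightLattice n) :=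
    { carrier := {η | p η}
      zero_mem' := zero
      add_mem' := fun {η θ} => add η θ
      neg_mem' := fun {η} => neg η }
  have h : η = ∑ i, η i • WeightLattice.eps i := by
    funext j
    simp [WeightLattice.eps, Finset.sum_apply, Pi.single_apply]
  change η ∈ S
  rw [h]
  exact sum_mem fun i _ => zsmul_mem (show WeightLattice.eps i ∈ S from eps i) _

end WeightLattice

namespace LaurentRing

open WeightLattice
open Equiv (swap)

variable {n : ℕ}

theorem e_neg_mul (η : WeightLattice n) : e (-η) * e η = 1 := by
  rw [← e_add, neg_add_cancel, e_zero]

theorem e_mul_neg (η : WeightLattice n) : e η * e (-η) = 1 := by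
  rw [← e_add, add_neg_cancel, e_zero]

theorem e_eps_sub_ne_zero {i k : Fin n} (h : k ≠ i) :
    (e (eps i) - e (eps k) : LaurentRing n) ≠ 0 := by
  rw [sub_ne_zero]
  intro h'
  exact h (eps_injective
    (AddMonoidAlgebra.single_left_injective (one_ne_zero : (1 : ℂ) ≠ 0) h')).symm

/-- The coefficient of `(1 - cᵢ cₖ) s_{ki}` in the commutator of `εᵢ^∨` and `e^η`. -/
def signedQuotient (η : WeightLattice n) (i k : Fin n) (h : k ≠ i) : LaurentRing n :=
  Int.sign ((k : ℤ) - i) • quotient η i k h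

/-- Both cases of the sign give the same formula, as
`sgn(k-i) (e^{εᵢ} - e^{εₖ}) = e^{ε_{min(i,k)}} (1 - e^{sgn(k-i) (εₖ-εᵢ)})`. -/
theorem sub_mul_signedQuotient (η : WeightLattice n) (i k : Fin n) (h : k ≠ i) :
    (e (eps i) - e (eps k)) * signedQuotient η i k h =
      e (eps (min i k)) * (e η - e (act (swap k i) η)) := by
  have hq := quotient_mul η i k h
  rw [← hq, signedQuotient]
  rcases lt_or_gt_of_ne h with hlt | hlt
  · rw [Int.sign_eq_neg_one_of_neg (by have := Fin.lt_def.1 hlt; omega), min_eq_right hlt.le,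
      neg_one_smul, neg_one_smul, neg_sub]
    have : (e (eps k) * e (eps i - eps k) : LaurentRing n) = e (eps i) := by
      rw [← e_add, add_sub_cancel]
    rw [← this]
    ring
  · rw [Int.sign_eq_one_of_pos (by have := Fin.lt_def.1 hlt; omega), min_eq_left hlt.le,
      one_smul, one_smul]
    have : (e (eps i) * e (eps k - eps i) : LaurentRing n) = e (eps k) := by
      rw [← e_add, add_sub_cancel]
    rw [← this]
    ring

theorem eq_signedQuotient {η : WeightLattice n} {i k : Fin n} (h : k ≠ i) {f : LaurentRing n}
    (hf : (e (eps i) - e (eps k)) * f = e (eps (min i k)) * (e η - e (act (swap k i) η))) :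
    signedQuotient η i k h = f :=
  mul_left_cancel₀ (e_eps_sub_ne_zero h) ((sub_mul_signedQuotient η i k h).trans hf.symm)

theorem signedQuotient_eps_left (i k : Fin n) (h : k ≠ i) :
    signedQuotient (eps i) i k h = e (eps (min i k)) :=
  eq_signedQuotient h (by rw [act_eps, Equiv.swap_apply_right, mul_comm])

theorem signedQuotient_eps_right (i k : Fin n) (h : k ≠ i) :
    signedQuotient (eps k) i k h = -e (eps (min i k)) :=
  eq_signedQuotient h (by rw [act_eps, Equiv.swap_apply_left]; ring)

theorem signedQuotient_eps (i j k : Fin n) (h : k ≠ i) (hi : j ≠ i) (hk : j ≠ k) :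
    signedQuotient (eps j) i k h = 0 :=
  eq_signedQuotient h (by rw [act_eps, Equiv.swap_apply_of_ne_of_ne hk hi, sub_self]; simp)

theorem signedQuotient_zero (i k : Fin n) (h : k ≠ i) : signedQuotient 0 i k h = 0 :=
  eq_signedQuotient h (by rw [show act (swap k i) (0 : WeightLattice n) = 0 from rfl]; simp)

theorem signedQuotient_add (η θ : WeightLattice n) (i k : Fin n) (h : k ≠ i) :
    signedQuotient (η + θ) i k h =
      signedQuotient η i k h * e (act (swap k i) θ) + e η * signedQuotient θ i k h := by
  refine eq_signedQuotient h ?_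
  rw [mul_add, ← mul_assoc, sub_mul_signedQuotient, mul_left_comm, sub_mul_signedQuotient, act_add,
    e_add, e_add]
  ring

section Commutator

variable {A : Type*} [Ring A] [Algebra ℂ A]

/-- An element that permutes the images of the `e^{εᵢ}` permutes the images of all `e^η`. -/
theorem mul_map_e_of_eps (L : LaurentRing n →ₐ[ℂ] A) (σ : Equiv.Perm (Fin n)) (a : A)
    (h : ∀ i, a * L (e (eps i)) = L (e (eps (σ i))) * a) (η : WeightLattice n) :
    a * L (e η) = L (e (act σ η)) * a := by
  induction η using induction_eps with
  | eps i => rw [h, act_eps]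
  | zero => rw [show act σ 0 = 0 from rfl, e_zero, map_one, mul_one, one_mul]
  | add η θ hη hθ =>
    rw [e_add, map_mul, ← mul_assoc, hη, mul_assoc, hθ, ← mul_assoc, ← map_mul, ← e_add, ← act_add]
  | neg η hη =>
    have h1 : L (e (act σ (-η))) * L (e (act σ η)) = 1 := by
      rw [← map_mul, ← e_add, ← act_add, neg_add_cancel]
      exact map_one L
    have h2 : L (e η) * L (e (-η)) = 1 := by rw [← map_mul, e_mul_neg, map_one]
    calc a * L (e (-η)) = L (e (act σ (-η))) * (L (e (act σ η)) * a) * L (e (-η)) := by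
          rw [← mul_assoc, h1, one_mul]
      _ = L (e (act σ (-η))) * a := by rw [← hη, mul_assoc, mul_assoc, h2, mul_one]

/-- Both sides of the relation between `εᵢ^∨` and `e^η` are twisted derivations in `η`, so that it
suffices to know the relation for the `e^{εⱼ}`. -/
theorem commutator_e_of_eps (L : LaurentRing n →ₐ[ℂ] A) (u : ℂ) (i : Fin n) (a : A) (T : Fin n → A)
    (hT : ∀ k η, T k * L (e η) = L (e (act (swap k i) η)) * T k)
    (h : ∀ j, a * L (e (eps j)) - L (e (eps j)) * a =
      u • ∑ k : {k : Fin n // k ≠ i}, L (signedQuotient (eps j) i k.1 k.2) * T k.1)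
    (η : WeightLattice n) :
    a * L (e η) - L (e η) * a =
      u • ∑ k : {k : Fin n // k ≠ i}, L (signedQuotient η i k.1 k.2) * T k.1 := by
  have hadd : ∀ η θ, (∑ k : {k : Fin n // k ≠ i}, L (signedQuotient (η + θ) i k.1 k.2) * T k.1) =
      (∑ k : {k : Fin n // k ≠ i}, L (signedQuotient η i k.1 k.2) * T k.1) * L (e θ) +
        L (e η) * ∑ k : {k : Fin n // k ≠ i}, L (signedQuotient θ i k.1 k.2) * T k.1 := by
    intro η θ
    rw [Finset.sum_mul, Finset.mul_sum, ← Finset.sum_add_distrib]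
    refine Finset.sum_congr rfl fun k _ => ?_
    rw [signedQuotient_add, map_add, map_mul, map_mul, add_mul (_ * _), mul_assoc _ (T k.1), hT,
      mul_assoc, mul_assoc]
  induction η using induction_eps with
  | eps j => exact h j
  | zero => simp [signedQuotient_zero, e_zero]
  | add η θ hη hθ =>
    rw [hadd, smul_add, ← smul_mul_assoc, ← hη, ← mul_smul_comm, ← hθ, e_add, map_mul]
    noncomm_ring
  | neg η hη =>
    have h0 := hadd η (-η)
    rw [add_neg_cancel] at h0
    simp only [signedQuotient_zero, map_zero, zero_mul, Finset.sum_const_zero] at h0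
    have h1 : L (e (-η)) * L (e η) = 1 := by rw [← map_mul, e_neg_mul, map_one]
    have h2 : L (e η) * L (e (-η)) = 1 := by rw [← map_mul, e_mul_neg, map_one]
    have h3 := congrArg (fun z => u • (L (e (-η)) * z)) h0
    simp only [mul_zero, smul_zero] at h3
    have h4 : L (e (-η)) * ((a * L (e η) - L (e η) * a) * L (e (-η))) =
        L (e (-η)) * a - a * L (e (-η)) := by
      rw [sub_mul, mul_sub, mul_assoc a, h2, mul_one, mul_assoc (L (e η)), ← mul_assoc _ (L (e η)),
        h1, one_mul]
    rw [mul_add, ← mul_assoc _ (L (e η)), h1, one_mul, smul_add, ← mul_smul_comm, ← smul_mul_assoc,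
      ← hη, h4] at h3
    rw [eq_neg_of_add_eq_zero_right h3.symm, neg_sub]

/-- The right-hand side of the relation between `εᵢ^∨` and `e^{εᵢ}`. -/
theorem sum_signedQuotient_eps_self (L : LaurentRing n →ₐ[ℂ] A) (i : Fin n) (T : Fin n → A) :
    ∑ k : {k : Fin n // k ≠ i}, L (signedQuotient (eps i) i k.1 k.2) * T k.1 =
      ∑ k with k ≠ i, L (e (eps (min i k))) * T k := by
  simp only [signedQuotient_eps_left]
  exact (Finset.sum_subtype (Finset.univ.filter fun k => k ≠ i) (by simp)
    fun k => L (e (eps (min i k))) * T k).symm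

/-- The right-hand side of the relation between `εᵢ^∨` and `e^{εⱼ}`, for `i ≠ j`. -/
theorem sum_signedQuotient_eps (L : LaurentRing n →ₐ[ℂ] A) {i j : Fin n} (hij : i ≠ j)
    (T : Fin n → A) :
    ∑ k : {k : Fin n // k ≠ i}, L (signedQuotient (eps j) i k.1 k.2) * T k.1 =
      -(L (e (eps (min i j))) * T j) := by
  rw [Finset.sum_eq_single (⟨j, hij.symm⟩ : {k : Fin n // k ≠ i})]
  · rw [signedQuotient_eps_right, map_neg, neg_mul]
  · rintro ⟨k, hk⟩ - hkj
    rw [signedQuotient_eps _ _ _ _ hij.symm (fun h => hkj (Subtype.ext h.symm)), map_zero, zero_mul]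
  · simp

end Commutator

end LaurentRing

/-! ### Families satisfying the trigonometric relations -/

section TrigFamily

open Equiv (swap)
open WeightLattice LaurentRing

variable {n : ℕ} {A : Type*} [Ring A] [Algebra ℂ A]

/-- A homomorphism `L` from `ℂ[P]` and elements `εᵢ^∨`, `cᵢ` and `s σ` of an algebra that satisfy
the defining relations of the trigonometric double affine Hecke-Clifford algebra. -/
structure IsTrigFamily (u : ℂ) (L : LaurentRing n →ₐ[ℂ] A) (ev c : Fin n → A)
    (s : Equiv.Perm (Fin n) → A) : Prop extends IsCliffordFamily c s where
  ev_ev (i j) : ev i * ev j = ev j * ev i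
  c_e (i j) : c j * L (e (eps i)) = L (e (eps i)) * c j
  s_e (σ i) : s σ * L (e (eps i)) = L (e (eps (σ i))) * s σ
  c_ev (i) : c i * ev i = -(ev i * c i)
  c_ev_ne (i j) : i ≠ j → c j * ev i = ev i * c j
  ev_s (i j : Fin n) : (j : ℕ) = i + 1 →
    ev j * s (swap i j) - s (swap i j) * ev i = u • (1 - c j * c i)
  ev_s_ne (i j k : Fin n) : (j : ℕ) = i + 1 → k ≠ i → k ≠ j →
    ev k * s (swap i j) = s (swap i j) * ev k
  ev_e (i η) : ev i * L (e η) - L (e η) * ev i =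
    u • ∑ k : {k : Fin n // k ≠ i}, L (signedQuotient η i k.1 k.2) * cliffordSwap c s i k.1

theorem TrigGen.map_ofLaurent (F : FreeAlgebra ℂ (TrigGen n) →ₐ[ℂ] A) (L : LaurentRing n →ₐ[ℂ] A)
    (h : ∀ η, F (TrigGen.E η) = L (LaurentRing.e η)) (f : LaurentRing n) :
    F (TrigGen.ofLaurent f) = L f := by
  have hL := DFunLike.congr_fun ((AddMonoidAlgebra.lift ℂ A _).apply_symm_apply L) f
  rw [AddMonoidAlgebra.lift_apply] at hL
  rw [← hL, TrigGen.ofLaurent, map_finsuppSum]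
  refine Finsupp.sum_congr fun η _ => ?_
  rw [map_smul, h]
  rfl

namespace TrigDaHCa

variable {u : ℂ}

theorem ofCliffordPerm_c (i : Fin n) : ofCliffordPerm n u (CliffordPerm.c i) = c i :=
  CliffordPerm.lift_c _ _ _ _ _ _ _ i

theorem ofCliffordPerm_s (σ : Equiv.Perm (Fin n)) : ofCliffordPerm n u (CliffordPerm.s σ) = s σ :=
  CliffordPerm.lift_s _ _ _ _ _ _ _ σ

theorem isCliffordFamily : IsCliffordFamily (c : Fin n → TrigDaHCa n u) s where
  s_one := s_one
  s_mul := s_mul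
  c_sq := c_sq
  c_c := c_c
  s_c := s_c

/-- The algebra homomorphism from the group algebra of the weight lattice. -/
def ofLaurent (n : ℕ) (u : ℂ) : LaurentRing n →ₐ[ℂ] TrigDaHCa n u :=
  AddMonoidAlgebra.lift ℂ _ _
    { toFun := fun η => e η.toAdd
      map_one' := by simpa [e] using mk_rel (.e_zero)
      map_mul' := fun η θ => by simpa [e] using mk_rel (.e_add η.toAdd θ.toAdd) }

theorem ofLaurent_e (η : WeightLattice n) : ofLaurent n u (LaurentRing.e η) = e η := by
  simp [ofLaurent, LaurentRing.e, AddMonoidAlgebra.lift_single]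

theorem isTrigFamily : IsTrigFamily u (ofLaurent n u) ev c s where
  toIsCliffordFamily := isCliffordFamily
  ev_ev i j := by simpa [ev] using mk_rel (.ev_ev i j)
  c_e i j := by rw [ofLaurent_e]; simpa [e, c] using mk_rel (.c_e i j)
  s_e σ i := by rw [ofLaurent_e, ofLaurent_e]; simpa [e, s] using mk_rel (.s_e σ i)
  c_ev i := by simpa [ev, c] using mk_rel (.c_ev i)
  c_ev_ne i j h := by simpa [ev, c] using mk_rel (.c_ev_ne i j h)
  ev_s i j h := by simpa [ev, s, c] using mk_rel (.ev_s i j h)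
  ev_s_ne i j k h hi hj := by simpa [ev, s] using mk_rel (.ev_s_ne i j k h hi hj)
  ev_e i η := by
    have h := mk_rel (u := u) (.ev_e i η)
    simp only [map_sub, map_mul, map_smul, map_sum, map_zsmul, map_one,
      TrigGen.map_ofLaurent (mk n u) (ofLaurent n u) (fun η => (ofLaurent_e η).symm)] at h
    rw [ofLaurent_e]
    refine h.trans ?_
    congr 1
    refine Finset.sum_congr rfl fun k _ => ?_
    rw [signedQuotient, map_zsmul, smul_mul_assoc, cliffordSwap, ← mul_assoc]
    rfl

/-- The algebra homomorphism given by a family satisfying the trigonometric relations. -/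
def lift {L : LaurentRing n →ₐ[ℂ] A} {EV C : Fin n → A} {S : Equiv.Perm (Fin n) → A}
    (h : IsTrigFamily u L EV C S) : TrigDaHCa n u →ₐ[ℂ] A :=
  RingQuot.liftAlgHom ℂ (s := TrigGen.Rel n u)
    ⟨FreeAlgebra.lift ℂ fun g => match g with
      | TrigGen.e η => L (LaurentRing.e η)
      | TrigGen.ev i => EV i
      | TrigGen.c i => C i
      | TrigGen.s σ => S σ, by
      intro a b hab
      cases hab <;> simp only [map_mul, map_one, map_neg, map_sub, map_smul, map_sum, map_zsmul,
        FreeAlgebra.lift_ι_apply]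
      case e_zero => rw [LaurentRing.e_zero, map_one]
      case e_add => rw [LaurentRing.e_add, map_mul]
      case s_one => exact h.s_one
      case s_mul => exact h.s_mul _ _
      case c_sq => exact h.c_sq _
      case c_c hij => exact h.c_c _ _ hij
      case ev_ev => exact h.ev_ev _ _
      case c_e => exact h.c_e _ _
      case s_e => exact h.s_e _ _
      case s_c => exact h.s_c _ _
      case c_ev => exact h.c_ev _
      case c_ev_ne hij => exact h.c_ev_ne _ _ hij
      case ev_s hij => exact h.ev_s _ _ hij
      case ev_s_ne hij hi hj => exact h.ev_s_ne _ _ _ hij hi hj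
      case ev_e i η =>
        rw [h.ev_e]
        congr 1
        refine Finset.sum_congr rfl fun k _ => ?_
        rw [TrigGen.map_ofLaurent _ L (fun η => FreeAlgebra.lift_ι_apply _ _), signedQuotient,
          map_zsmul, smul_mul_assoc, cliffordSwap, ← mul_assoc]⟩

section lift

variable {L : LaurentRing n →ₐ[ℂ] A} {EV C : Fin n → A} {S : Equiv.Perm (Fin n) → A}
    (h : IsTrigFamily u L EV C S)

theorem lift_e (η : WeightLattice n) : lift h (e η) = L (LaurentRing.e η) :=
  (RingQuot.liftAlgHom_mkAlgHom_apply ℂ _ _ _).trans (FreeAlgebra.lift_ι_apply _ _)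

theorem lift_ev (i : Fin n) : lift h (ev i) = EV i :=
  (RingQuot.liftAlgHom_mkAlgHom_apply ℂ _ _ _).trans (FreeAlgebra.lift_ι_apply _ _)

theorem lift_c (i : Fin n) : lift h (c i) = C i :=
  (RingQuot.liftAlgHom_mkAlgHom_apply ℂ _ _ _).trans (FreeAlgebra.lift_ι_apply _ _)

theorem lift_s (σ : Equiv.Perm (Fin n)) : lift h (s σ) = S σ :=
  (RingQuot.liftAlgHom_mkAlgHom_apply ℂ _ _ _).trans (FreeAlgebra.lift_ι_apply _ _)

end lift

end TrigDaHCa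

end TrigFamily

/-! ### The Dunkl family in the trigonometric algebra -/

section TrigToRational

open Equiv (swap)
open WeightLattice LaurentRing

variable {n : ℕ} {A : Type*} [Ring A] [Algebra ℂ A]

/-- A family permuted by the adjacent transpositions is permuted by `Sₙ`. -/
theorem s_mul_of_adjacent {B : Type*} [Ring B] {s : Equiv.Perm (Fin n) → B} (s_one : s 1 = 1)
    (s_mul : ∀ σ τ, s (σ * τ) = s σ * s τ) {z : Fin n → B}
    (h : ∀ i j k : Fin n, (j : ℕ) = i + 1 → s (swap i j) * z k = z (swap i j k) * s (swap i j))
    (σ : Equiv.Perm (Fin n)) (k : Fin n) : s σ * z k = z (σ k) * s σ := by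
  cases n with
  | zero => exact k.elim0
  | succ m =>
    have hσ : σ ∈ Submonoid.closure
        (Set.range fun i : Fin m => swap i.castSucc i.succ) := by
      rw [Equiv.Perm.mclosure_swap_castSucc_succ]; trivial
    induction hσ using Submonoid.closure_induction generalizing k with
    | mem τ hτ =>
      obtain ⟨i, rfl⟩ := hτ
      exact h _ _ _ (by simp)
    | one => rw [s_one, one_mul, mul_one, Equiv.Perm.one_apply]
    | mul σ τ _ _ hσ hτ =>
      rw [s_mul, mul_assoc, hτ, ← mul_assoc, hσ, mul_assoc, Equiv.Perm.mul_apply]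

namespace IsTrigFamily

variable {u : ℂ} {L : LaurentRing n →ₐ[ℂ] A} {ev c : Fin n → A} {s : Equiv.Perm (Fin n) → A}

/-- Subtracting the Jucys-Murphy elements makes the `εᵢ^∨` a family permuted by `Sₙ`. -/
theorem s_mul_sub_jucysMurphy (h : IsTrigFamily u L ev c s) (σ : Equiv.Perm (Fin n)) (k : Fin n) :
    s σ * (ev k - u • jucysMurphy c s k) = (ev (σ k) - u • jucysMurphy c s (σ k)) * s σ := by
  refine s_mul_of_adjacent (z := fun k => ev k - u • jucysMurphy c s k) h.s_one h.s_mul ?_ σ k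
  intro i j k hij
  have h1 : s (swap i j) * (ev i - u • jucysMurphy c s i) =
      (ev j - u • jucysMurphy c s j) * s (swap i j) := by
    have h2 := h.ev_s i j hij
    rw [← h.jucysMurphy_mul_s_adjacent hij, ← sub_eq_zero] at h2
    rw [eq_comm, ← sub_eq_zero, ← h2]
    simp only [sub_mul, mul_sub, smul_sub, smul_mul_assoc, mul_smul_comm]
    abel
  by_cases hi : k = i
  · rw [hi, Equiv.swap_apply_left]
    exact h1
  by_cases hj : k = j
  · rw [hj, Equiv.swap_apply_right]
    have h2 := congrArg (fun z => s (swap i j) * z * s (swap i j)) h1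
    simp only [mul_assoc, h.s_swap_mul_self, mul_one] at h2
    rw [← mul_assoc, h.s_swap_mul_self, one_mul] at h2
    exact h2.symm
  · rw [Equiv.swap_apply_of_ne_of_ne hi hj, mul_sub, sub_mul, h.ev_s_ne i j k hij hi hj,
      mul_smul_comm, smul_mul_assoc, h.jucysMurphy_mul_s_adjacent_ne hij hi hj]

theorem c_mul_e (h : IsTrigFamily u L ev c s) (j : Fin n) (η : WeightLattice n) :
    c j * L (e η) = L (e η) * c j :=
  mul_map_e_of_eps L 1 (c j) (fun i => h.c_e i j) η

theorem s_mul_e (h : IsTrigFamily u L ev c s) (σ : Equiv.Perm (Fin n)) (η : WeightLattice n) :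
    s σ * L (e η) = L (e (act σ η)) * s σ :=
  mul_map_e_of_eps L σ (s σ) (fun i => h.s_e σ i) η

/-- The images of the generators `xᵢ` of the rational algebra. -/
def x (u : ℂ) (L : LaurentRing n →ₐ[ℂ] A) (ev c : Fin n → A) (s : Equiv.Perm (Fin n) → A)
    (i : Fin n) : A :=
  L (e (-eps i)) * (ev i - u • jucysMurphy c s i)

theorem y_mul_x (i : Fin n) : L (e (eps i)) * x u L ev c s i = ev i - u • jucysMurphy c s i := by
  rw [x, ← mul_assoc, ← map_mul, e_mul_neg, map_one, one_mul]

theorem y_mul_cancel {i : Fin n} {a b : A} (h : L (e (eps i)) * a = L (e (eps i)) * b) : a = b := by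
  have h1 := congrArg (fun z => L (e (-eps i)) * z) h
  simpa only [← mul_assoc, ← map_mul, e_neg_mul, map_one, one_mul] using h1

theorem y_mul_x_add (i : Fin n) :
    L (e (eps i)) * x u L ev c s i + u • jucysMurphy c s i = ev i := by
  rw [y_mul_x, sub_add_cancel]

theorem y_y (L : LaurentRing n →ₐ[ℂ] A) (i j : Fin n) :
    L (e (eps i)) * L (e (eps j)) = L (e (eps j)) * L (e (eps i)) := by
  rw [← map_mul, mul_comm, map_mul]

theorem y_mul_x_y_commutator (i j : Fin n) :
    L (e (eps i)) * (x u L ev c s i * L (e (eps j)) - L (e (eps j)) * x u L ev c s i) =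
      (ev i * L (e (eps j)) - L (e (eps j)) * ev i) -
        u • (jucysMurphy c s i * L (e (eps j)) - L (e (eps j)) * jucysMurphy c s i) := by
  rw [mul_sub, ← mul_assoc, y_mul_x, ← mul_assoc, y_y, mul_assoc, y_mul_x]
  simp only [sub_mul, mul_sub, smul_sub, smul_mul_assoc, mul_smul_comm]
  abel

theorem isDunklFamily (h : IsTrigFamily u L ev c s) :
    IsDunklFamily u (x u L ev c s) (fun i => L (e (eps i))) c s where
  toIsCliffordFamily := h.toIsCliffordFamily
  y_y := y_y L
  s_x σ i := by
    have hneg : act σ (-eps i) = -eps (σ i) := congrArg Neg.neg (act_eps σ i)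
    rw [x, ← mul_assoc, h.s_mul_e, mul_assoc, h.s_mul_sub_jucysMurphy, ← mul_assoc, hneg, x]
  s_y := h.s_e
  c_x i := by
    rw [x, ← mul_assoc, h.c_mul_e, mul_assoc, mul_assoc, ← mul_neg]
    congr 1
    rw [mul_sub, h.c_ev, mul_smul_comm, h.c_mul_jucysMurphy_self, sub_mul, smul_neg, smul_mul_assoc]
    abel
  c_x_ne i j hij := by
    rw [x, ← mul_assoc, h.c_mul_e, mul_assoc, mul_assoc]
    congr 1
    rw [mul_sub, h.c_ev_ne i j hij, mul_smul_comm, h.c_mul_jucysMurphy hij.symm, sub_mul,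
      smul_mul_assoc]
  c_y := h.c_e
  x_y_ne i j hij := by
    refine y_mul_cancel (L := L) (i := i) ?_
    rw [y_mul_x_y_commutator, h.ev_e, sum_signedQuotient_eps L hij,
      jucysMurphy_mul_even_commutator (y := fun i => L (e (eps i))) h.s_e h.c_e hij, ← smul_sub,
      mul_neg, mul_smul_comm, ← smul_neg]
    congr 1
    rw [sub_mul]
    abel
  x_y i := by
    refine y_mul_cancel (L := L) (i := i) ?_
    rw [y_mul_x_y_commutator, h.ev_e, sum_signedQuotient_eps_self L,
      jucysMurphy_mul_even_commutator_self (y := fun i => L (e (eps i))) h.s_e h.c_e, ← smul_sub,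
      mul_smul_comm, ← Finset.sum_sub_distrib, Finset.mul_sum]
    congr 1
    refine Finset.sum_congr rfl fun k _ => ?_
    rw [sub_mul]
    abel

/-- As the `εᵢ^∨` commute and the `e^{εᵢ}` are invertible, the `xᵢ` commute. -/
theorem x_x (h : IsTrigFamily u L ev c s) (i j : Fin n) :
    x u L ev c s i * x u L ev c s j = x u L ev c s j * x u L ev c s i := by
  have h1 := h.isDunklFamily.commutator i j
  simp only [y_mul_x_add] at h1
  rw [h.ev_ev, sub_self, mul_assoc] at h1
  rw [← sub_eq_zero]
  refine y_mul_cancel (L := L) (i := j) (y_mul_cancel (L := L) (i := i) ?_)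
  rw [← h1, mul_zero, mul_zero]

end IsTrigFamily

end TrigToRational

/-! ### The homomorphism `ι` -/

section Iota

open WeightLattice LaurentRing

variable {n : ℕ} {u : ℂ}

/-- The homomorphism from the rational to the trigonometric algebra. -/
def rationalToTrig (n : ℕ) (u : ℂ) : RationalDaHCa n u →ₐ[ℂ] TrigDaHCa n u :=
  RationalDaHCa.lift TrigDaHCa.isTrigFamily.isDunklFamily TrigDaHCa.isTrigFamily.x_x

theorem rationalToTrig_x (i : Fin n) : rationalToTrig n u (RationalDaHCa.x i) =
    TrigDaHCa.e (-eps i) *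
      (TrigDaHCa.ev i - u • jucysMurphy TrigDaHCa.c TrigDaHCa.s i) := by
  rw [rationalToTrig, RationalDaHCa.lift_x, IsTrigFamily.x, TrigDaHCa.ofLaurent_e]

theorem rationalToTrig_y (i : Fin n) :
    rationalToTrig n u (RationalDaHCa.y i) = TrigDaHCa.e (eps i) :=
  (RationalDaHCa.lift_y _ _ i).trans (TrigDaHCa.ofLaurent_e _)

theorem rationalToTrig_c (i : Fin n) :
    rationalToTrig n u (RationalDaHCa.c i) = TrigDaHCa.c i := RationalDaHCa.lift_c _ _ i

theorem rationalToTrig_s (σ : Equiv.Perm (Fin n)) :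
    rationalToTrig n u (RationalDaHCa.s σ) = TrigDaHCa.s σ := RationalDaHCa.lift_s _ _ σ

theorem isRationalToTrig_rationalToTrig : IsRationalToTrig (rationalToTrig n u) where
  extends_id := CliffordPerm.algHom_ext
    (fun i => by
      rw [AlgHom.comp_apply, RationalDaHCa.ofCliffordPerm_c, rationalToTrig_c,
        TrigDaHCa.ofCliffordPerm_c])
    (fun σ => by
      rw [AlgHom.comp_apply, RationalDaHCa.ofCliffordPerm_s, rationalToTrig_s,
        TrigDaHCa.ofCliffordPerm_s])
  map_y := rationalToTrig_y
  map_x := rationalToTrig_x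

theorem IsRationalToTrig.eq_rationalToTrig {ι : RationalDaHCa n u →ₐ[ℂ] TrigDaHCa n u}
    (h : IsRationalToTrig ι) : ι = rationalToTrig n u := by
  refine RationalDaHCa.algHom_ext (fun i => ?_) (fun i => ?_) (fun i => ?_) (fun σ => ?_)
  · rw [h.map_x, rationalToTrig_x]; rfl
  · rw [h.map_y, rationalToTrig_y]
  · have h1 := DFunLike.congr_fun h.extends_id (CliffordPerm.c i)
    rwa [AlgHom.comp_apply, RationalDaHCa.ofCliffordPerm_c, TrigDaHCa.ofCliffordPerm_c,
      ← rationalToTrig_c] at h1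
  · have h1 := DFunLike.congr_fun h.extends_id (CliffordPerm.s σ)
    rwa [AlgHom.comp_apply, RationalDaHCa.ofCliffordPerm_s, TrigDaHCa.ofCliffordPerm_s,
      ← rationalToTrig_s] at h1

theorem parity_rationalToTrig (a : RationalDaHCa n u) :
    TrigDaHCa.parity n u (rationalToTrig n u a) =
      rationalToTrig n u (RationalDaHCa.parity n u a) := by
  have h : (TrigDaHCa.parity n u).comp (rationalToTrig n u) =
      (rationalToTrig n u).comp (RationalDaHCa.parity n u) := by
    refine RationalDaHCa.algHom_ext (fun i => ?_) (fun i => ?_) (fun i => ?_) (fun σ => ?_)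
    · simp [RationalDaHCa.parity_x, rationalToTrig_x, TrigDaHCa.parity_e, TrigDaHCa.parity_ev,
        TrigDaHCa.parity_c, TrigDaHCa.parity_s, jucysMurphy, cliffordSwap]
    · simp [RationalDaHCa.parity_y, rationalToTrig_y, TrigDaHCa.parity_e]
    · simp [RationalDaHCa.parity_c, rationalToTrig_c, TrigDaHCa.parity_c]
    · simp [RationalDaHCa.parity_s, rationalToTrig_s, TrigDaHCa.parity_s]
  exact DFunLike.congr_fun h a

/-- The homomorphism `ι` of superalgebras. -/
def gradedRationalToTrig (n : ℕ) (u : ℂ) :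
    RationalDaHCa.grading n u →ₐᵍ[ℂ] TrigDaHCa.grading n u :=
  { rationalToTrig n u with
    map_mem := fun {i a} ha => by
      rw [mem_parityGrading] at ha
      change TrigDaHCa.parity n u (rationalToTrig n u a) = _ • rationalToTrig n u a
      rw [parity_rationalToTrig, ha, map_smul] }

end Iota

/-! ### The homomorphism `j` and the isomorphism -/

namespace LocalizedDaHCa

open WeightLattice LaurentRing

variable {n : ℕ} {u : ℂ}

theorem ofLaurent_e_eps (i : Fin n) :
    ofLaurent n u (e (eps i)) = ofRational n u (RationalDaHCa.y i) := by
  rw [← LaurentRing.algebraMap_X, ofLaurent_algebraMap, RationalDaHCa.poly_X]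

theorem map_cliffordSwap (i k : Fin n) :
    ofRational n u (cliffordSwap RationalDaHCa.c RationalDaHCa.s i k) =
      cliffordSwap (fun i => ofRational n u (RationalDaHCa.c i))
        (fun σ => ofRational n u (RationalDaHCa.s σ)) i k := by
  simp [cliffordSwap]

theorem isCliffordFamily : IsCliffordFamily (fun i : Fin n => ofRational n u (RationalDaHCa.c i))
    (fun σ => ofRational n u (RationalDaHCa.s σ)) where
  s_one := by rw [RationalDaHCa.s_one, map_one]
  s_mul σ τ := by rw [RationalDaHCa.s_mul, map_mul]
  c_sq i := by rw [← map_mul, RationalDaHCa.c_sq, map_one]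
  c_c i j hij := by rw [← map_mul, RationalDaHCa.c_c i j hij, map_neg, map_mul]
  s_c σ i := by rw [← map_mul, RationalDaHCa.s_c, map_mul]

/-- The elements of the rational algebra that are the images of the `εᵢ^∨`. -/
def ev (u : ℂ) (i : Fin n) : RationalDaHCa n u :=
  RationalDaHCa.y i * RationalDaHCa.x i +
    u • jucysMurphy RationalDaHCa.c RationalDaHCa.s i

/-- The elements `yᵢ xᵢ + u ∑_{k<i} (1 - cᵢ cₖ) s_{ki}` and the Laurent polynomials in the `yᵢ` satisfy
the trigonometric relations. -/
theorem isTrigFamily : IsTrigFamily u (ofLaurent n u) (fun i => ofRational n u (ev u i))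
    (fun i => ofRational n u (RationalDaHCa.c i))
    (fun σ => ofRational n u (RationalDaHCa.s σ)) where
  toIsCliffordFamily := isCliffordFamily
  ev_ev i j := by
    rw [← map_mul, ← map_mul, ← sub_eq_zero, ← map_sub, ev, ev,
      RationalDaHCa.isDunklFamily.commutator, RationalDaHCa.x_x, sub_self, mul_zero, map_zero]
  c_e i j := by rw [ofLaurent_e_eps, ← map_mul, RationalDaHCa.c_y, map_mul]
  s_e σ i := by rw [ofLaurent_e_eps, ofLaurent_e_eps, ← map_mul, RationalDaHCa.s_y, map_mul]
  c_ev i := by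
    have h := RationalDaHCa.isDunklFamily (n := n) (u := u)
    rw [← map_mul, ← map_mul, ← map_neg]
    congr 1
    rw [ev, mul_add, ← mul_assoc, h.c_y, mul_assoc, h.c_x, mul_smul_comm, h.c_mul_jucysMurphy_self,
      add_mul, smul_mul_assoc, mul_neg, smul_neg, mul_assoc, neg_add]
  c_ev_ne i j hij := by
    have h := RationalDaHCa.isDunklFamily (n := n) (u := u)
    rw [← map_mul, ← map_mul]
    congr 1
    rw [ev, mul_add, ← mul_assoc, h.c_y, mul_assoc, h.c_x_ne i j hij, mul_smul_comm,
      h.c_mul_jucysMurphy hij.symm, add_mul, smul_mul_assoc, mul_assoc]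
  ev_s i j hij := by
    have h := RationalDaHCa.isDunklFamily (n := n) (u := u)
    have h1 := h.jucysMurphy_mul_s_adjacent hij
    have h2 : ev u j * RationalDaHCa.s (Equiv.swap i j) - RationalDaHCa.s (Equiv.swap i j) * ev u i =
        u • (1 - RationalDaHCa.c j * RationalDaHCa.c i) := by
      rw [← h1, ev, ev, mul_add, ← mul_assoc, h.s_y, mul_assoc, h.s_x, Equiv.swap_apply_left]
      simp only [add_mul, smul_sub, mul_smul_comm, smul_mul_assoc, mul_assoc]
      abel
    have h3 := congrArg (ofRational n u) h2
    simpa only [map_sub, map_mul, map_smul, map_one] using h3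
  ev_s_ne i j k hij hi hj := by
    have h := RationalDaHCa.isDunklFamily (n := n) (u := u)
    rw [← map_mul, ← map_mul]
    congr 1
    rw [ev, mul_add, ← mul_assoc, h.s_y, mul_assoc, h.s_x, Equiv.swap_apply_of_ne_of_ne hi hj,
      mul_smul_comm, ← h.jucysMurphy_mul_s_adjacent_ne hij hi hj, add_mul, smul_mul_assoc,
      mul_assoc]
  ev_e i η := by
    have h := RationalDaHCa.isDunklFamily (n := n) (u := u)
    refine commutator_e_of_eps (ofLaurent n u) u i _ _ (fun k η => ?_) (fun j => ?_) η
    · refine mul_map_e_of_eps _ _ _ (fun j => ?_) η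
      rw [ofLaurent_e_eps, ofLaurent_e_eps, ← map_cliffordSwap, ← map_mul,
        cliffordSwap_mul_even h.s_y h.c_y, map_mul]
    · by_cases hij : i = j
      · subst hij
        rw [sum_signedQuotient_eps_self]
        simp only [ofLaurent_e_eps, ← map_cliffordSwap, ← map_mul, ← map_sub, ← map_sum, ← map_smul]
        congr 1
        exact h.euler_y_commutator_self i
      · rw [sum_signedQuotient_eps _ hij]
        simp only [ofLaurent_e_eps, ← map_cliffordSwap, ← map_mul, ← map_sub, ← map_neg, ← map_smul]
        congr 1
        rw [smul_neg]
        exact h.euler_y_commutator hij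

end LocalizedDaHCa

section Isomorphism

open WeightLattice LaurentRing

variable {n : ℕ} {u : ℂ}

/-- The homomorphism from the trigonometric to the localized rational algebra. -/
def trigToLocalized (n : ℕ) (u : ℂ) : TrigDaHCa n u →ₐ[ℂ] LocalizedDaHCa n u :=
  TrigDaHCa.lift LocalizedDaHCa.isTrigFamily

theorem trigToLocalized_ofLaurent (p : LaurentRing n) :
    trigToLocalized n u (TrigDaHCa.ofLaurent n u p) = LocalizedDaHCa.ofLaurent n u p := by
  have h : (trigToLocalized n u).comp (TrigDaHCa.ofLaurent n u) = LocalizedDaHCa.ofLaurent n u := by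
    refine (AddMonoidAlgebra.lift ℂ _ _).symm.injective (MonoidHom.ext fun η => ?_)
    change trigToLocalized n u (TrigDaHCa.ofLaurent n u (e η.toAdd)) =
      LocalizedDaHCa.ofLaurent n u (e η.toAdd)
    rw [TrigDaHCa.ofLaurent_e]
    exact TrigDaHCa.lift_e _ _
  exact DFunLike.congr_fun h p

theorem trigToLocalized_ev (i : Fin n) : trigToLocalized n u (TrigDaHCa.ev i) =
    LocalizedDaHCa.ofRational n u (LocalizedDaHCa.ev u i) := TrigDaHCa.lift_ev _ i

theorem trigToLocalized_c (i : Fin n) : trigToLocalized n u (TrigDaHCa.c i) =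
    LocalizedDaHCa.ofRational n u (RationalDaHCa.c i) := TrigDaHCa.lift_c _ i

theorem trigToLocalized_s (σ : Equiv.Perm (Fin n)) : trigToLocalized n u (TrigDaHCa.s σ) =
    LocalizedDaHCa.ofRational n u (RationalDaHCa.s σ) := TrigDaHCa.lift_s _ σ

theorem isTrigToLocalized_trigToLocalized : IsTrigToLocalized (trigToLocalized n u) where
  extends_id := CliffordPerm.algHom_ext
    (fun i => by
      rw [AlgHom.comp_apply, AlgHom.comp_apply, RationalDaHCa.ofCliffordPerm_c,
        TrigDaHCa.ofCliffordPerm_c, trigToLocalized_c])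
    (fun σ => by
      rw [AlgHom.comp_apply, AlgHom.comp_apply, RationalDaHCa.ofCliffordPerm_s,
        TrigDaHCa.ofCliffordPerm_s, trigToLocalized_s])
  map_e i := by
    rw [← TrigDaHCa.ofLaurent_e, trigToLocalized_ofLaurent, LocalizedDaHCa.ofLaurent_e_eps]
  map_ev := trigToLocalized_ev

theorem rationalToTrig_ev (i : Fin n) :
    rationalToTrig n u (LocalizedDaHCa.ev u i) = TrigDaHCa.ev i := by
  have h : rationalToTrig n u (jucysMurphy RationalDaHCa.c RationalDaHCa.s i) =
      jucysMurphy TrigDaHCa.c TrigDaHCa.s i := by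
    simp [jucysMurphy, cliffordSwap, rationalToTrig_c, rationalToTrig_s]
  rw [LocalizedDaHCa.ev, map_add, map_mul, map_smul, h, rationalToTrig_y, rationalToTrig_x,
    ← mul_assoc, ← TrigDaHCa.ofLaurent_e, ← TrigDaHCa.ofLaurent_e, ← map_mul, e_mul_neg, map_one,
    one_mul, sub_add_cancel]

/-- The composite of the maps to and from the trigonometric algebra is the localization map. -/
theorem trigToLocalized_rationalToTrig (h : RationalDaHCa n u) :
    trigToLocalized n u (rationalToTrig n u h) = LocalizedDaHCa.ofRational n u h := by
  have hcomp : (trigToLocalized n u).comp (rationalToTrig n u) =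
      LocalizedDaHCa.ofRational n u := by
    have hy : ∀ i : Fin n, trigToLocalized n u (rationalToTrig n u (RationalDaHCa.y i)) =
        LocalizedDaHCa.ofRational n u (RationalDaHCa.y i) := fun i => by
      rw [rationalToTrig_y]
      exact isTrigToLocalized_trigToLocalized.map_e i
    refine RationalDaHCa.algHom_ext (fun i => ?_) hy (fun i => ?_) (fun σ => ?_)
    · -- `ι(xᵢ)` is determined by `ι(yᵢ xᵢ)`, as `yᵢ` becomes invertible
      have h1 := congrArg (trigToLocalized n u) (rationalToTrig_ev (u := u) i)
      have h2 : trigToLocalized n u (rationalToTrig n u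
          (jucysMurphy RationalDaHCa.c RationalDaHCa.s i)) =
          LocalizedDaHCa.ofRational n u (jucysMurphy RationalDaHCa.c RationalDaHCa.s i) := by
        simp [jucysMurphy, cliffordSwap, rationalToTrig_c, rationalToTrig_s, trigToLocalized_c,
          trigToLocalized_s]
      rw [trigToLocalized_ev, LocalizedDaHCa.ev] at h1
      simp only [map_add, map_mul, map_smul, h2, hy, add_left_inj] at h1
      rw [← LocalizedDaHCa.ofLaurent_e_eps] at h1
      exact IsTrigFamily.y_mul_cancel h1
    · rw [AlgHom.comp_apply, rationalToTrig_c, trigToLocalized_c]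
    · rw [AlgHom.comp_apply, rationalToTrig_s, trigToLocalized_s]
  exact DFunLike.congr_fun hcomp h

theorem rationalToTrig_poly (r : PolyRing n) : rationalToTrig n u (RationalDaHCa.poly n u r) =
    TrigDaHCa.ofLaurent n u (algebraMap (PolyRing n) (LaurentRing n) r) := by
  have h : (rationalToTrig n u).comp (RationalDaHCa.poly n u) = (TrigDaHCa.ofLaurent n u).comp
      (IsScalarTower.toAlgHom ℂ (PolyRing n) (LaurentRing n)) := by
    refine MvPolynomial.algHom_ext fun i => ?_
    rw [AlgHom.comp_apply, AlgHom.comp_apply, IsScalarTower.coe_toAlgHom', RationalDaHCa.poly_X,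
      LaurentRing.algebraMap_X, rationalToTrig_y, TrigDaHCa.ofLaurent_e]
  exact DFunLike.congr_fun h r

/-- The additive map `p ⊗ h ↦ p ι(h)`. -/
def localizedToTrig (n : ℕ) (u : ℂ) : LocalizedDaHCa n u →+ TrigDaHCa n u :=
  TensorProduct.liftAddHom
    (AddMonoidHom.mul.compl₂ (rationalToTrig n u : RationalDaHCa n u →+ TrigDaHCa n u) |>.comp
      (TrigDaHCa.ofLaurent n u : LaurentRing n →+ TrigDaHCa n u))
    (fun r p h => by
      change TrigDaHCa.ofLaurent n u (r • p) * rationalToTrig n u h =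
        TrigDaHCa.ofLaurent n u p * rationalToTrig n u (r • h)
      rw [RationalDaHCa.poly_smul, map_mul, rationalToTrig_poly, Algebra.smul_def, mul_comm, map_mul,
        mul_assoc])

theorem localizedToTrig_tmul (p : LaurentRing n) (h : RationalDaHCa n u) :
    localizedToTrig n u (LocalizedDaHCa.tmul p h) =
      TrigDaHCa.ofLaurent n u p * rationalToTrig n u h := rfl

theorem trigToLocalized_localizedToTrig (b : LocalizedDaHCa n u) :
    trigToLocalized n u (localizedToTrig n u b) = b := by
  induction b using LocalizedDaHCa.induction_on with
  | zero => rw [map_zero, map_zero]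
  | tmul p h =>
    rw [localizedToTrig_tmul, map_mul, trigToLocalized_ofLaurent, trigToLocalized_rationalToTrig]
    exact (LocalizedDaHCa.tmul_eq p h).symm
  | add a b ha hb => rw [map_add, map_add, ha, hb]

theorem localizedToTrig_mul_ofRational (b : LocalizedDaHCa n u) (k : RationalDaHCa n u) :
    localizedToTrig n u (b * LocalizedDaHCa.ofRational n u k) =
      localizedToTrig n u b * rationalToTrig n u k := by
  induction b using LocalizedDaHCa.induction_on with
  | zero => rw [zero_mul, map_zero, zero_mul]
  | tmul p h =>
    change localizedToTrig n u (_ * LocalizedDaHCa.tmul 1 k) = _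
    rw [LocalizedDaHCa.tmul_mul_one_tmul, localizedToTrig_tmul, localizedToTrig_tmul, map_mul,
      mul_assoc]
  | add a b ha hb => rw [add_mul, map_add, ha, hb, map_add, add_mul]

theorem localizedToTrig_mul_ofLaurent_e (b : LocalizedDaHCa n u) (η : WeightLattice n) :
    localizedToTrig n u (b * LocalizedDaHCa.ofLaurent n u (e η)) =
      localizedToTrig n u b * TrigDaHCa.e η := by
  rw [← TrigDaHCa.ofLaurent_e]
  induction η using induction_eps generalizing b with
  | eps i =>
    rw [LocalizedDaHCa.ofLaurent_e_eps, localizedToTrig_mul_ofRational, rationalToTrig_y,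
      TrigDaHCa.ofLaurent_e]
  | zero => rw [e_zero, map_one, map_one, mul_one, mul_one]
  | add η θ hη hθ =>
    rw [e_add, map_mul (LocalizedDaHCa.ofLaurent n u), map_mul (TrigDaHCa.ofLaurent n u),
      ← mul_assoc, hθ, hη, mul_assoc]
  | neg η hη =>
    have h := hη (b * LocalizedDaHCa.ofLaurent n u (e (-η)))
    rw [mul_assoc, ← map_mul, e_neg_mul, map_one, mul_one] at h
    rw [h, mul_assoc, ← map_mul, e_mul_neg, map_one, mul_one]

theorem localizedToTrig_mul_trigToLocalized (b : LocalizedDaHCa n u) (t : TrigDaHCa n u) :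
    localizedToTrig n u (b * trigToLocalized n u t) = localizedToTrig n u b * t := by
  -- it suffices to treat the generators `t`
  obtain ⟨a, rfl⟩ := TrigDaHCa.mk_surjective t
  induction a using FreeAlgebra.induction generalizing b with
  | grade0 r =>
    have h := localizedToTrig_mul_ofRational b (algebraMap ℂ _ r)
    rwa [AlgHom.commutes, AlgHom.commutes, ← AlgHom.commutes (trigToLocalized n u),
      ← AlgHom.commutes (TrigDaHCa.mk n u)] at h
  | add a a' ha ha' => rw [map_add, map_add, mul_add, map_add, ha, ha', mul_add]
  | mul a a' ha ha' =>
    rw [map_mul (TrigDaHCa.mk n u), map_mul (trigToLocalized n u), ← mul_assoc, ha', ha, mul_assoc]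
  | grade1 g =>
    cases g with
    | e η =>
      change localizedToTrig n u (b * trigToLocalized n u (TrigDaHCa.e η)) = _ * TrigDaHCa.e η
      rw [← localizedToTrig_mul_ofLaurent_e, ← TrigDaHCa.ofLaurent_e, trigToLocalized_ofLaurent]
    | ev i =>
      change localizedToTrig n u (b * trigToLocalized n u (TrigDaHCa.ev i)) = _ * TrigDaHCa.ev i
      rw [trigToLocalized_ev, localizedToTrig_mul_ofRational, rationalToTrig_ev]
    | c i =>
      change localizedToTrig n u (b * trigToLocalized n u (TrigDaHCa.c i)) = _ * TrigDaHCa.c i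
      rw [trigToLocalized_c, localizedToTrig_mul_ofRational, rationalToTrig_c]
    | s σ =>
      change localizedToTrig n u (b * trigToLocalized n u (TrigDaHCa.s σ)) = _ * TrigDaHCa.s σ
      rw [trigToLocalized_s, localizedToTrig_mul_ofRational, rationalToTrig_s]

theorem localizedToTrig_trigToLocalized (t : TrigDaHCa n u) :
    localizedToTrig n u (trigToLocalized n u t) = t := by
  have h := localizedToTrig_mul_trigToLocalized 1 t
  rwa [one_mul, LocalizedDaHCa.one_def, localizedToTrig_tmul, map_one, map_one, one_mul,
    one_mul] at h

/-- The isomorphism of the trigonometric with the localized rational algebra. -/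
def trigEquivLocalized (n : ℕ) (u : ℂ) : TrigDaHCa n u ≃ₐ[ℂ] LocalizedDaHCa n u :=
  AlgEquiv.ofBijective (trigToLocalized n u)
    ⟨Function.LeftInverse.injective localizedToTrig_trigToLocalized,
      Function.RightInverse.surjective trigToLocalized_localizedToTrig⟩

end Isomorphism

/-! ### Divided differences of polynomials -/

section DividedDifference

open MvPolynomial
open Equiv (swap)

variable {n : ℕ}

/-- The divided difference `(p - s_{ki} p) / (yᵢ - yₖ)`, for `k ≠ i`. Divisibility is part of
`RationalDaHCa.exists_x_poly`, for any value of the parameter. -/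
def dividedDifference (i k : Fin n) (hk : k ≠ i) : Module.End ℂ (PolyRing n) :=
  have h (p : PolyRing n) : ∃ q, (X i - X k) * q = p - rename (swap k i) p :=
    let ⟨g, hg, _⟩ := RationalDaHCa.exists_x_poly (u := 0) i p
    ⟨g k, hg k⟩
  have hne : (X i - X k : PolyRing n) ≠ 0 := sub_ne_zero.2 fun h => hk (X_injective h).symm
  { toFun p := (h p).choose
    map_add' p q := mul_left_cancel₀ hne (by
      rw [mul_add, (h _).choose_spec, (h _).choose_spec, (h _).choose_spec, map_add]; ring)
    map_smul' t p := mul_left_cancel₀ hne (by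
      rw [RingHom.id_apply, mul_smul_comm, (h _).choose_spec, (h _).choose_spec, map_smul,
        smul_sub]) }

theorem mul_dividedDifference {i k : Fin n} (hk : k ≠ i) (p : PolyRing n) :
    (X i - X k) * dividedDifference i k hk p = p - rename (swap k i) p := by
  have h : ∃ q, (X i - X k) * q = p - rename (swap k i) p :=
    let ⟨g, hg, _⟩ := RationalDaHCa.exists_x_poly (u := 0) i p
    ⟨g k, hg k⟩
  exact h.choose_spec

theorem eq_dividedDifference {i k : Fin n} (hk : k ≠ i) {p q : PolyRing n}
    (h : (X i - X k) * q = p - rename (swap k i) p) : dividedDifference i k hk p = q :=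
  mul_left_cancel₀ (sub_ne_zero.2 fun h => hk (X_injective h).symm)
    ((mul_dividedDifference hk p).trans h.symm)

theorem dividedDifference_one {i k : Fin n} (hk : k ≠ i) : dividedDifference i k hk 1 = 0 :=
  eq_dividedDifference hk (by rw [map_one, sub_self, mul_zero])

/-- The commutator of a divided difference and multiplication by a polynomial `q` of which the
divided difference is `r`. -/
theorem dividedDifference_mul {i k : Fin n} (hk : k ≠ i) {q r : PolyRing n}
    (h : (X i - X k) * r = q - rename (swap k i) q) (p : PolyRing n) :
    dividedDifference i k hk (q * p) =
      q * dividedDifference i k hk p + r * rename (swap k i) p := by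
  refine eq_dividedDifference hk ?_
  rw [mul_add, mul_left_comm, mul_dividedDifference, ← mul_assoc, h, map_mul]
  ring

theorem rename_dividedDifference (σ : Equiv.Perm (Fin n)) {i k : Fin n} (hk : k ≠ i)
    (p : PolyRing n) : rename σ (dividedDifference i k hk p) =
      dividedDifference (σ i) (σ k) (σ.injective.ne hk) (rename σ p) := by
  refine (eq_dividedDifference _ ?_).symm
  have h := congrArg (rename σ) (mul_dividedDifference hk p)
  rw [map_mul, map_sub, rename_X, rename_X, map_sub] at h
  rw [h, rename_rename, rename_rename]
  congr 3
  funext l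
  exact DFunLike.congr_fun (Equiv.mul_swap_eq_swap_mul σ k i) l

/-- The algebra of linear operators on `ℂ[y]`. -/
def PolyEnd (n : ℕ) : Type := Module.End ℂ (PolyRing n)

instance (n : ℕ) : Ring (PolyEnd n) := inferInstanceAs (Ring (Module.End ℂ (PolyRing n)))
instance (n : ℕ) : Algebra ℂ (PolyEnd n) :=
  inferInstanceAs (Algebra ℂ (Module.End ℂ (PolyRing n)))

namespace PolyEnd

/-- The operator of divided difference. -/
def diff (i k : Fin n) (hk : k ≠ i) : PolyEnd n := dividedDifference i k hk

/-- The operator of multiplication by a variable. -/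
def mulX (i : Fin n) : PolyEnd n := LinearMap.mulLeft ℂ (X i)

/-- The operator of permutation of the variables. -/
def perm (σ : Equiv.Perm (Fin n)) : PolyEnd n := (rename σ).toLinearMap

theorem perm_one : (perm 1 : PolyEnd n) = 1 :=
  LinearMap.ext fun p => rename_id_apply p

theorem perm_mul (σ τ : Equiv.Perm (Fin n)) : perm (σ * τ) = perm σ * perm τ :=
  LinearMap.ext fun p => (rename_rename τ σ p).symm

theorem mulX_mul_mulX (i j : Fin n) : mulX i * mulX j = mulX j * mulX i :=
  LinearMap.ext fun p => mul_left_comm (X i) (X j) p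

theorem perm_mul_mulX (σ : Equiv.Perm (Fin n)) (i : Fin n) :
    perm σ * mulX i = mulX (σ i) * perm σ :=
  LinearMap.ext fun p => by
    change rename σ (X i * p) = X (σ i) * rename σ p
    rw [map_mul, rename_X]

theorem perm_mul_diff (σ : Equiv.Perm (Fin n)) {i k : Fin n} (hk : k ≠ i) :
    perm σ * diff i k hk = diff (σ i) (σ k) (σ.injective.ne hk) * perm σ :=
  LinearMap.ext fun p => rename_dividedDifference σ hk p

theorem diff_mulX_left {i k : Fin n} (hk : k ≠ i) :
    diff i k hk * mulX i - mulX i * diff i k hk = perm (swap k i) :=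
  LinearMap.ext fun p => by
    change dividedDifference i k hk (X i * p) - X i * dividedDifference i k hk p =
      rename (swap k i) p
    rw [dividedDifference_mul hk (r := 1), one_mul, add_sub_cancel_left]
    rw [rename_X, Equiv.swap_apply_right, mul_one]

theorem diff_mulX_right {i k : Fin n} (hk : k ≠ i) :
    diff i k hk * mulX k - mulX k * diff i k hk = -perm (swap k i) :=
  LinearMap.ext fun p => by
    change dividedDifference i k hk (X k * p) - X k * dividedDifference i k hk p =
      -rename (swap k i) p
    rw [dividedDifference_mul hk (r := -1), neg_one_mul, add_sub_cancel_left]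
    rw [rename_X, Equiv.swap_apply_left, mul_neg_one, neg_sub]

theorem diff_mulX {i j k : Fin n} (hk : k ≠ i) (hi : j ≠ i) (hjk : j ≠ k) :
    diff i k hk * mulX j - mulX j * diff i k hk = 0 :=
  LinearMap.ext fun p => by
    change dividedDifference i k hk (X j * p) - X j * dividedDifference i k hk p = 0
    rw [dividedDifference_mul hk (r := 0), zero_mul, add_zero, sub_self]
    rw [rename_X, Equiv.swap_apply_of_ne_of_ne hjk hi, mul_zero, sub_self]

end PolyEnd

end DividedDifference

/-! ### The induced module of the rational algebra -/

namespace RationalDaHCa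

open Equiv (swap)

variable {n : ℕ} {u : ℂ}

/-- The algebra of operators on `ℂ[y] ⊗ Ḧᶜ` in which the induced action is defined. -/
abbrev InducedOps (n : ℕ) (u : ℂ) : Type := PolyEnd n ⊗[ℂ] RationalDaHCa n u

/-- The Dunkl operator of index `i`. -/
def inducedX (u : ℂ) (i : Fin n) : InducedOps n u :=
  1 ⊗ₜ x i + ∑ k : {k : Fin n // k ≠ i}, PolyEnd.diff i k.1 k.2 ⊗ₜ (u • cliffordSwap c s i k.1)

/-- Multiplication by `yᵢ` on polynomials. -/
def inducedY (u : ℂ) (i : Fin n) : InducedOps n u :=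
  PolyEnd.mulX i ⊗ₜ 1

/-- The Clifford generators act on the second tensor factor only. -/
def inducedC (u : ℂ) (i : Fin n) : InducedOps n u := 1 ⊗ₜ c i

/-- The permutations act diagonally. -/
def inducedS (u : ℂ) (σ : Equiv.Perm (Fin n)) : InducedOps n u :=
  PolyEnd.perm σ ⊗ₜ s σ

theorem cliffordSwap_induced (i k : Fin n) :
    cliffordSwap (inducedC u) (inducedS u) i k =
      PolyEnd.perm (swap k i) ⊗ₜ cliffordSwap c s i k := by
  rw [cliffordSwap, inducedC, inducedC, inducedS, Algebra.TensorProduct.tmul_mul_tmul, sub_mul,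
    one_mul, Algebra.TensorProduct.tmul_mul_tmul, one_mul, one_mul, ← TensorProduct.tmul_sub,
    cliffordSwap, sub_mul, one_mul]

theorem inducedX_mul_inducedY (i j : Fin n) :
    inducedX u i * inducedY u j - inducedY u j * inducedX u i =
      ∑ k : {k : Fin n // k ≠ i}, (PolyEnd.diff i k.1 k.2 * PolyEnd.mulX j -
        PolyEnd.mulX j * PolyEnd.diff i k.1 k.2) ⊗ₜ (u • cliffordSwap c s i k.1) := by
  simp only [inducedX, inducedY, add_mul, mul_add, Finset.sum_mul, Finset.mul_sum,
    Algebra.TensorProduct.tmul_mul_tmul, one_mul, mul_one, TensorProduct.sub_tmul,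
    Finset.sum_sub_distrib]
  abel

theorem isDunklFamily_induced :
    IsDunklFamily u (inducedX (n := n) u) (inducedY u) (inducedC u) (inducedS u) where
  s_one := by
    rw [inducedS, s_one, PolyEnd.perm_one, Algebra.TensorProduct.one_def]
  s_mul σ τ := by
    rw [inducedS, inducedS, inducedS, Algebra.TensorProduct.tmul_mul_tmul, s_mul,
      PolyEnd.perm_mul]
  c_sq i := by
    rw [inducedC, Algebra.TensorProduct.tmul_mul_tmul, c_sq, one_mul,
      Algebra.TensorProduct.one_def]
  c_c i j hij := by
    rw [inducedC, inducedC, Algebra.TensorProduct.tmul_mul_tmul,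
      Algebra.TensorProduct.tmul_mul_tmul, c_c i j hij, TensorProduct.tmul_neg]
  s_c σ i := by
    rw [inducedC, inducedC, inducedS, Algebra.TensorProduct.tmul_mul_tmul,
      Algebra.TensorProduct.tmul_mul_tmul, s_c, one_mul, mul_one]
  y_y i j := by
    rw [inducedY, inducedY, Algebra.TensorProduct.tmul_mul_tmul,
      Algebra.TensorProduct.tmul_mul_tmul, PolyEnd.mulX_mul_mulX]
  s_x σ i := by
    have h := isDunklFamily (n := n) (u := u)
    rw [inducedX, inducedX, inducedS, mul_add, add_mul, Algebra.TensorProduct.tmul_mul_tmul,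
      Algebra.TensorProduct.tmul_mul_tmul, h.s_x, one_mul, mul_one, Finset.mul_sum, Finset.sum_mul]
    congr 1
    refine Fintype.sum_equiv
      (σ.subtypeEquiv fun k => (σ.injective.ne_iff (x := k) (y := i)).symm) _ _ fun k => ?_
    rw [Algebra.TensorProduct.tmul_mul_tmul, Algebra.TensorProduct.tmul_mul_tmul, mul_smul_comm,
      h.s_mul_cliffordSwap, smul_mul_assoc, PolyEnd.perm_mul_diff]
    rfl
  s_y σ i := by
    rw [inducedY, inducedY, inducedS, Algebra.TensorProduct.tmul_mul_tmul,
      Algebra.TensorProduct.tmul_mul_tmul, one_mul, mul_one, PolyEnd.perm_mul_mulX]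
  c_x i := by
    have h := isDunklFamily (n := n) (u := u)
    rw [inducedX, inducedC, mul_add, add_mul, Algebra.TensorProduct.tmul_mul_tmul,
      Algebra.TensorProduct.tmul_mul_tmul, h.c_x, one_mul, TensorProduct.tmul_neg, Finset.mul_sum,
      Finset.sum_mul, neg_add, ← Finset.sum_neg_distrib]
    congr 1
    refine Finset.sum_congr rfl fun k _ => ?_
    rw [Algebra.TensorProduct.tmul_mul_tmul, Algebra.TensorProduct.tmul_mul_tmul, mul_smul_comm,
      h.c_mul_cliffordSwap_self, smul_mul_assoc, smul_neg, TensorProduct.tmul_neg, one_mul, mul_one]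
  c_x_ne i j hij := by
    have h := isDunklFamily (n := n) (u := u)
    rw [inducedX, inducedC, mul_add, add_mul, Algebra.TensorProduct.tmul_mul_tmul,
      Algebra.TensorProduct.tmul_mul_tmul, h.c_x_ne i j hij, Finset.mul_sum, Finset.sum_mul]
    congr 1
    refine Finset.sum_congr rfl fun k _ => ?_
    rw [Algebra.TensorProduct.tmul_mul_tmul, Algebra.TensorProduct.tmul_mul_tmul, mul_smul_comm,
      h.c_mul_cliffordSwap k.2.symm hij.symm, smul_mul_assoc, one_mul, mul_one]
  c_y i j := by
    rw [inducedY, inducedC, Algebra.TensorProduct.tmul_mul_tmul,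
      Algebra.TensorProduct.tmul_mul_tmul, one_mul, mul_one, one_mul, mul_one]
  x_y_ne i j hij := by
    rw [inducedX_mul_inducedY, cliffordSwap_induced, ← TensorProduct.tmul_smul,
      ← TensorProduct.neg_tmul, Finset.sum_eq_single ⟨j, hij.symm⟩]
    · rw [PolyEnd.diff_mulX_right, Equiv.swap_comm]
    · rintro ⟨k, hk⟩ - hkj
      rw [PolyEnd.diff_mulX hk hij.symm fun h => hkj (Subtype.ext h.symm), TensorProduct.zero_tmul]
    · simp
  x_y i := by
    rw [inducedX_mul_inducedY, Finset.smul_sum,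
      Finset.sum_subtype (Finset.univ.filter fun k => k ≠ i) (p := fun k => k ≠ i) (by simp)
        (fun k => u • cliffordSwap (inducedC u) (inducedS u) i k)]
    refine Finset.sum_congr rfl fun k _ => ?_
    rw [cliffordSwap_induced, ← TensorProduct.tmul_smul, PolyEnd.diff_mulX_left]

/-- The induced module, i.e. the free `ℂ[y]`-module `ℂ[y] ⊗ Ḧᶜ`. -/
abbrev InducedModule (n : ℕ) (u : ℂ) : Type := PolyRing n ⊗[ℂ] RationalDaHCa n u

/-- The action of operators on the induced module. -/
def inducedOpsAct (n : ℕ) (u : ℂ) : InducedOps n u →ₐ[ℂ] Module.End ℂ (InducedModule n u) :=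
  (Module.endTensorEndAlgHom (R := ℂ) (S := ℂ) (A := ℂ)).comp
    (Algebra.TensorProduct.map (AlgHom.id ℂ (Module.End ℂ (PolyRing n)))
      (Algebra.lmul ℂ (RationalDaHCa n u)))

theorem inducedOpsAct_tmul (f : PolyEnd n) (a : RationalDaHCa n u) (p : PolyRing n)
    (b : RationalDaHCa n u) :
    inducedOpsAct n u (f ⊗ₜ a) (p ⊗ₜ b) =
      (show Module.End ℂ (PolyRing n) from f) p ⊗ₜ (a * b) := rfl

theorem inducedX_act (i : Fin n) (p : PolyRing n) (b : RationalDaHCa n u) :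
    inducedOpsAct n u (inducedX u i) (p ⊗ₜ b) = p ⊗ₜ (x i * b) +
      ∑ k : {k : Fin n // k ≠ i},
        dividedDifference i k.1 k.2 p ⊗ₜ (u • cliffordSwap c s i k.1 * b) := by
  rw [inducedX, map_add, map_sum, LinearMap.add_apply, LinearMap.sum_apply]
  rfl

theorem inducedY_act (i : Fin n) (z : InducedModule n u) :
    inducedOpsAct n u (inducedY u i) z = (MvPolynomial.X i : PolyRing n) • z := by
  induction z using TensorProduct.induction_on with
  | zero => rw [map_zero, smul_zero]
  | add z w hz hw => rw [map_add, hz, hw, smul_add]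
  | tmul p b =>
    rw [inducedY, inducedOpsAct_tmul, one_mul, TensorProduct.smul_tmul']
    rfl

/-- The Dunkl operators commute: their commutators commute with the `yᵢ`, and vanish on `1 ⊗ Ḧᶜ`, as
the divided differences vanish there. -/
theorem inducedX_commute (i j : Fin n) :
    inducedOpsAct n u (inducedX u i) * inducedOpsAct n u (inducedX u j) =
      inducedOpsAct n u (inducedX u j) * inducedOpsAct n u (inducedX u i) := by
  rw [← map_mul, ← map_mul]
  refine sub_eq_zero.1 ((map_sub (inducedOpsAct n u) _ _).symm.trans ?_)
  set z := inducedX u i * inducedX u j - inducedX u j * inducedX u i with hz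
  have h1 : ∀ b : RationalDaHCa n u, inducedOpsAct n u z ((1 : PolyRing n) ⊗ₜ b) = 0 := by
    intro b
    have hx : ∀ (i : Fin n) (b : RationalDaHCa n u),
        inducedOpsAct n u (inducedX u i) ((1 : PolyRing n) ⊗ₜ b) = 1 ⊗ₜ (x i * b) := by
      intro i b
      simp [inducedX_act, dividedDifference_one]
    rw [hz, map_sub (inducedOpsAct n u), map_mul, map_mul]
    refine (LinearMap.sub_apply _ _ _).trans ?_
    rw [Module.End.mul_apply,
      Module.End.mul_apply, hx, hx, hx, hx, ← mul_assoc, x_x, mul_assoc, sub_self]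
  have h2 : ∀ (p : PolyRing n) (w : InducedModule n u),
      inducedOpsAct n u z (p • w) = p • inducedOpsAct n u z w := by
    intro p w
    induction p using MvPolynomial.induction_on generalizing w with
    | C a => rw [← MvPolynomial.algebraMap_eq, algebraMap_smul, algebraMap_smul, map_smul]
    | add p q hp hq => rw [add_smul, map_add, hp, hq, add_smul]
    | mul_X p k hp =>
      have h3 := isDunklFamily_induced.x_commutator_mul_y (u := u) i j k
      rw [← hz] at h3
      rw [mul_smul, hp, ← inducedY_act, ← Module.End.mul_apply, ← map_mul, h3, map_mul,
        Module.End.mul_apply, inducedY_act, mul_smul]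
  refine LinearMap.ext fun w => ?_
  induction w using TensorProduct.induction_on with
  | zero => rw [map_zero, map_zero]
  | add w w' hw hw' => rw [map_add, hw, hw', map_add]
  | tmul p b =>
    have h3 : p ⊗ₜ[ℂ] b = p • ((1 : PolyRing n) ⊗ₜ[ℂ] b) := by
      rw [TensorProduct.smul_tmul', smul_eq_mul, mul_one]
    rw [h3, h2, h1, smul_zero, LinearMap.zero_apply]

end RationalDaHCa

theorem IsDunklFamily.map {n : ℕ} {u : ℂ} {A B : Type*} [Ring A] [Algebra ℂ A] [Ring B]
    [Algebra ℂ B] {x y c : Fin n → A} {s : Equiv.Perm (Fin n) → A} (h : IsDunklFamily u x y c s)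
    (f : A →ₐ[ℂ] B) :
    IsDunklFamily u (fun i => f (x i)) (fun i => f (y i)) (fun i => f (c i)) (fun σ => f (s σ)) := by
  have hT : ∀ i k, cliffordSwap (fun i => f (c i)) (fun σ => f (s σ)) i k =
      f (cliffordSwap c s i k) := fun i k => by simp [cliffordSwap]
  constructor
  · constructor
    · rw [h.s_one, map_one]
    · intro σ τ; rw [h.s_mul, map_mul]
    · intro i; rw [← map_mul, h.c_sq, map_one]
    · intro i j hij; rw [← map_mul, ← map_mul, h.c_c i j hij, map_neg]
    · intro σ i; rw [← map_mul, ← map_mul, h.s_c]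
  · intro i j; rw [← map_mul, ← map_mul, h.y_y]
  · intro σ i; rw [← map_mul, ← map_mul, h.s_x]
  · intro σ i; rw [← map_mul, ← map_mul, h.s_y]
  · intro i; rw [← map_mul, ← map_mul, h.c_x, map_neg]
  · intro i j hij; rw [← map_mul, ← map_mul, h.c_x_ne i j hij]
  · intro i j; rw [← map_mul, ← map_mul, h.c_y]
  · intro i j hij; rw [← map_mul, ← map_mul, ← map_sub, h.x_y_ne i j hij, hT, map_neg, map_smul]
  · intro i; simp only [hT, ← map_mul, ← map_sub, h.x_y, map_smul, map_sum]

namespace RationalDaHCa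

open Equiv (swap)

variable {n : ℕ} {u : ℂ}

/-- The action of the rational algebra on the induced module. -/
def inducedAct (n : ℕ) (u : ℂ) : RationalDaHCa n u →ₐ[ℂ] Module.End ℂ (InducedModule n u) :=
  lift (A := Module.End ℂ (InducedModule n u)) (isDunklFamily_induced.map (inducedOpsAct n u))
    inducedX_commute

/-- The multiplication map `p ⊗ h ↦ p h` of the induced module to `Ḧᶜ`. -/
def inducedMul (n : ℕ) (u : ℂ) : InducedModule n u →ₗ[PolyRing n] RationalDaHCa n u :=
  LinearMap.liftBaseChange (PolyRing n) LinearMap.id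

theorem inducedMul_tmul (p : PolyRing n) (h : RationalDaHCa n u) :
    inducedMul n u (p ⊗ₜ h) = poly n u p * h := rfl

/-- The commutator of `xᵢ` and a polynomial in the `yᵢ`, in terms of divided differences. -/
theorem x_mul_poly (i : Fin n) (p : PolyRing n) : x i * poly n u p = poly n u p * x i +
    ∑ k : {k : Fin n // k ≠ i}, poly n u (dividedDifference i k.1 k.2 p) *
      (u • cliffordSwap c s i k.1) := by
  obtain ⟨g, hg, hg'⟩ := exists_x_poly (u := u) i p
  rw [← sub_eq_iff_eq_add', hg',
    Finset.sum_subtype (Finset.univ.filter fun k => k ≠ i) (p := fun k => k ≠ i) (by simp)]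
  refine Finset.sum_congr rfl fun k _ => ?_
  rw [eq_dividedDifference k.2 (hg k.1), isCliffordFamily.cliffordSwap_eq k.2.symm]

theorem inducedMul_act (h : RationalDaHCa n u) (z : InducedModule n u) :
    inducedMul n u (inducedAct n u h z) = h * inducedMul n u z := by
  obtain ⟨a, rfl⟩ := mk_surjective h
  induction a using FreeAlgebra.induction generalizing z with
  | grade0 r =>
    rw [AlgHom.commutes, AlgHom.commutes, Module.algebraMap_end_apply, ← Algebra.smul_def,
      ← algebraMap_smul (PolyRing n) r z, map_smul, algebraMap_smul]
  | add a b ha hb => rw [map_add, map_add, LinearMap.add_apply, map_add, ha, hb, add_mul]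
  | mul a b ha hb => rw [map_mul, map_mul, Module.End.mul_apply, ha, hb, mul_assoc]
  | grade1 g =>
    induction z using TensorProduct.induction_on with
    | zero => rw [map_zero, map_zero, mul_zero]
    | add z w hz hw => rw [map_add, map_add, hz, hw, map_add, mul_add]
    | tmul p b =>
      cases g with
      | x i =>
        change inducedMul n u (inducedAct n u (x i) _) = x i * _
        rw [inducedAct, lift_x, inducedX_act, map_add, map_sum, inducedMul_tmul, inducedMul_tmul,
          ← mul_assoc (x i), x_mul_poly, add_mul, mul_assoc, Finset.sum_mul]
        simp only [inducedMul_tmul, mul_assoc]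
      | y i =>
        change inducedMul n u (inducedAct n u (y i) _) = y i * _
        rw [inducedAct, lift_y, inducedY_act, map_smul, poly_smul, poly_X]
      | c i =>
        change inducedMul n u (inducedAct n u (c i) _) = c i * _
        rw [inducedAct, lift_c, inducedC, inducedOpsAct_tmul, inducedMul_tmul, inducedMul_tmul,
          ← mul_assoc, ← mul_assoc, c_poly]
        rfl
      | s σ =>
        change inducedMul n u (inducedAct n u (s σ) _) = s σ * _
        rw [inducedAct, lift_s, inducedS, inducedOpsAct_tmul, inducedMul_tmul, inducedMul_tmul,
          ← mul_assoc, ← mul_assoc, s_poly]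
        rfl

theorem inducedAct_poly (p : PolyRing n) (z : InducedModule n u) :
    inducedAct n u (poly n u p) z = p • z := by
  have h : (inducedAct n u).comp (poly n u) =
        (Algebra.lsmul ℂ ℂ (InducedModule n u) : PolyRing n →ₐ[ℂ] _) := by
    refine MvPolynomial.algHom_ext fun i => LinearMap.ext fun z => ?_
    rw [AlgHom.comp_apply, poly_X, inducedAct, lift_y, inducedY_act]
    rfl
  exact LinearMap.congr_fun (DFunLike.congr_fun h p) z

/-- The map `h ↦ h (1 ⊗ 1)` to the induced module. -/
def toInduced (n : ℕ) (u : ℂ) : RationalDaHCa n u →ₗ[PolyRing n] InducedModule n u where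
  toFun h := inducedAct n u h (1 ⊗ₜ 1)
  map_add' a b := by rw [map_add, LinearMap.add_apply]
  map_smul' p a := by
    rw [poly_smul, map_mul, Module.End.mul_apply, inducedAct_poly, RingHom.id_apply]

/-- The rational algebra is flat over `ℂ[y]`, being a direct summand of the induced module. -/
instance : Module.Flat (PolyRing n) (RationalDaHCa n u) :=
  Module.Flat.of_retract (toInduced n u) (inducedMul n u) (LinearMap.ext fun h => by
    change inducedMul n u (inducedAct n u h (1 ⊗ₜ 1)) = h
    rw [inducedMul_act, inducedMul_tmul, map_one, mul_one, mul_one])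

end RationalDaHCa

/-! ### Injectivity of the localization map -/

theorem LaurentRing.algebraMap_coeff {n : ℕ} (p : PolyRing n) (μ : Fin n →₀ ℕ) :
    (algebraMap (PolyRing n) (LaurentRing n) p).coeff (fun i => (μ i : ℤ)) =
      MvPolynomial.coeff μ p := by
  induction p using MvPolynomial.induction_on' with
  | add p q hp hq => rw [map_add, MvPolynomial.coeff_add, ← hp, ← hq]; rfl
  | monomial ν a =>
    have h : algebraMap (PolyRing n) (LaurentRing n) (MvPolynomial.monomial ν a) =
        AddMonoidAlgebra.single (fun i => (ν i : ℤ)) a := by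
      rw [MvPolynomial.monomial_eq, Finsupp.prod_fintype _ _ (fun i => pow_zero _), map_mul,
        LocalizedDaHCa.algebraMap_monomial, ← MvPolynomial.algebraMap_eq,
        ← IsScalarTower.algebraMap_apply, ← Algebra.smul_def, LaurentRing.e,
        AddMonoidAlgebra.smul_single, smul_eq_mul, mul_one]
    have hμν : (fun i => (ν i : ℤ)) = (fun i => (μ i : ℤ)) ↔ ν = μ := by
      simp [funext_iff, Finsupp.ext_iff]
    rw [h, AddMonoidAlgebra.coeff_single, Finsupp.single_apply, MvPolynomial.coeff_monomial]
    simp only [hμν]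

instance {n : ℕ} : FaithfulSMul (PolyRing n) (LaurentRing n) :=
  (faithfulSMul_iff_algebraMap_injective _ _).2 fun p q h => MvPolynomial.ext _ _ fun μ => by
    rw [← LaurentRing.algebraMap_coeff, h, LaurentRing.algebraMap_coeff]

theorem LocalizedDaHCa.ofRational_injective {n : ℕ} {u : ℂ} :
    Function.Injective (LocalizedDaHCa.ofRational n u) :=
  Module.Flat.tensorProduct_mk_injective (PolyRing n) (RationalDaHCa n u) (LaurentRing n)

theorem rationalToTrig_injective {n : ℕ} {u : ℂ} : Function.Injective (rationalToTrig n u) := by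
  refine Function.Injective.of_comp (f := trigToLocalized n u) ?_
  rw [show trigToLocalized n u ∘ rationalToTrig n u = LocalizedDaHCa.ofRational n u from
    funext trigToLocalized_rationalToTrig]
  exact LocalizedDaHCa.ofRational_injective

end

theorem mainTheorem8 (n : ℕ) (u : ℂ) :
    (∃! ι : RationalDaHCa.grading n u →ₐᵍ[ℂ] TrigDaHCa.grading n u,
      IsRationalToTrig ι.toAlgHom) ∧
    ∀ ι : RationalDaHCa.grading n u →ₐᵍ[ℂ] TrigDaHCa.grading n u,
      IsRationalToTrig ι.toAlgHom →
        Function.Injective ι ∧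
        ∃ Φ : LocalizedDaHCa n u ≃ₐ[ℂ] TrigDaHCa n u,
          (∀ h : RationalDaHCa n u, Φ (LocalizedDaHCa.ofRational n u h) = ι h) ∧
          IsTrigToLocalized (Φ.symm : TrigDaHCa n u →ₐ[ℂ] LocalizedDaHCa n u) := by
  have heq : ∀ ι : RationalDaHCa.grading n u →ₐᵍ[ℂ] TrigDaHCa.grading n u,
      IsRationalToTrig ι.toAlgHom → ∀ h, ι h = rationalToTrig n u h :=
    fun ι hι => DFunLike.congr_fun hι.eq_rationalToTrig
  refine ⟨⟨gradedRationalToTrig n u, isRationalToTrig_rationalToTrig, fun ι hι => ?_⟩,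
    fun ι hι => ⟨?_, (trigEquivLocalized n u).symm, fun h => ?_, ?_⟩⟩
  · exact DFunLike.ext _ _ (heq ι hι)
  · intro a b hab
    rw [heq ι hι, heq ι hι] at hab
    exact rationalToTrig_injective hab
  · rw [heq ι hι, AlgEquiv.symm_apply_eq]
    exact (trigToLocalized_rationalToTrig h).symm
  · exact isTrigToLocalized_trigToLocalized
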